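/- Let $d\ge 1$, let $H\ge 0$ be a self-adjoint (in general unbounded) operator on $L^2(\mathbb R^d)$ with spectral measure $E$, so that $H=\int\lambda\,dE_\lambda$. Write $\langle H\rangle=(1+H^2)^{1/2}$ and, for integers $N\ge 0$, $P_N=\mathbf 1_{[N,N+1)}(H)=E([N,N+1))$. Let $\gamma>0$ and let $\Psi:\mathbb R^d\to\mathbb R$ be continuous; put $\|\Psi g\|_{L^2(\mathbb R^d)}=+\infty$ when $\Psi g\notin L^2(\mathbb R^d)$. Then the following two conditions are equivalent. (i) There exists $C_1>0$ such that for all $f\in L^2(\mathbb R^d)$ in the domain of $\langle H\rangle^{\gamma/2}$ (a dense subspace of $L^2(\mathbb R^d)$) $$\Big(\int_0^{2\pi}\big\|\Psi\,\langle H\rangle^{\gamma/2}e^{-itH}f\big\|_{L^2(\mathbb R^d)}^2\,dt\Big)^{1/2}\le C_1\|f\|_{L^2(\mathbb R^d)}.$$ (ii) There exists $C_2>0$ such that for all integers $N\ge 1$ and all $f\in L^2(\mathbb R^d)$ $$\|\Psi P_Nf\|_{L^2(\mathbb R^d)}\le C_2N^{-\gamma/2}\|P_Nf\|_{L^2(\mathbb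 R^d)},$$ and there exists $C_0>0$ such that $\|\Psi P_0f\|_{L^2(\mathbb R^d)}\le C_0\|P_0f\|_{L^2(\mathbb R^d)}$ for all $f\in L^2(\mathbb R^d)$. -/

import Mathlib

open MeasureTheory
open scoped ENNReal

noncomputable section

section SpectralCalculus

variable {𝓗 : Type*} [NormedAddCommGroup 𝓗] [InnerProductSpace ℂ 𝓗] [CompleteSpace 𝓗]

/-- A projection-valued measure (resolution of the identity) on the Borel sets of `ℝ`, with values
in the orthogonal projections of the Hilbert space `𝓗`. Only its values on Borel sets matter. -/
structure ProjectionMeasure (𝓗 : Type*) [NormedAddCommGroup 𝓗] [InnerProductSpace ℂ 𝓗]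
    [CompleteSpace 𝓗] where
  /-- The projection `E(B)`. -/
  proj : Set ℝ → 𝓗 →L[ℂ] 𝓗
  isStarProjection : ∀ B, MeasurableSet B → IsStarProjection (proj B)
  empty : proj ∅ = 0
  univ : proj Set.univ = 1
  inter : ∀ A B, MeasurableSet A → MeasurableSet B → proj (A ∩ B) = proj A * proj B
  hasSum : ∀ A : ℕ → Set ℝ, (∀ n, MeasurableSet (A n)) → Pairwise (Function.onFun Disjoint A) →
    ∀ f : 𝓗, HasSum (fun n => proj (A n) f) (proj (⋃ n, A n) f)

namespace ProjectionMeasure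

theorem norm_sq_proj (E : ProjectionMeasure 𝓗) {B : Set ℝ} (hB : MeasurableSet B) (f : 𝓗) :
    ‖E.proj B f‖ ^ 2 = RCLike.re (inner ℂ f (E.proj B f)) := by
  have h := E.isStarProjection B hB
  have h1 : E.proj B (E.proj B f) = E.proj B f := by
    have := h.isIdempotentElem
    exact congrArg (fun T : 𝓗 →L[ℂ] 𝓗 => T f) this
  have h2 := h.isSelfAdjoint.isSymmetric f (E.proj B f)
  simp only [ContinuousLinearMap.coe_coe] at h2
  rw [h1] at h2
  rw [← h2, inner_self_eq_norm_sq]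

/-- The scalar spectral measure `μ_f(B) = ‖E(B) f‖² = ⟨f, E(B) f⟩`. -/
def scalarMeasure (E : ProjectionMeasure 𝓗) (f : 𝓗) : Measure ℝ :=
  Measure.ofMeasurable (fun B _ => ENNReal.ofReal (‖E.proj B f‖ ^ 2))
    (by simp [E.empty])
    (by
      intro A hA hdisj
      have hs := E.hasSum A hA hdisj f
      have hs2 : HasSum (fun n => ‖E.proj (A n) f‖ ^ 2) (‖E.proj (⋃ n, A n) f‖ ^ 2) := by
        rw [E.norm_sq_proj (MeasurableSet.iUnion hA)]
        simp_rw [E.norm_sq_proj (hA _)]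
        exact (hs.mapL (innerSL ℂ f)).mapL (RCLike.reCLM (K := ℂ))
      rw [← hs2.tsum_eq, ENNReal.ofReal_tsum_of_nonneg (fun n => by positivity) hs2.summable])

/-- The integral `∫ s dE f = ∑ c, c • E({s = c}) f` of a simple function `s`. -/
def simpleIntegral (E : ProjectionMeasure 𝓗) (s : SimpleFunc ℝ ℂ) (f : 𝓗) : 𝓗 :=
  ∑ c ∈ s.range, c • E.proj (s ⁻¹' {c}) f

/-- `E.IsIntegral φ f h` says that `f` is in the domain of `∫ φ dE`, which is
`{f | ∫ |φ|² dμ_f < ∞}`, and that `h = (∫ φ dE) f`: the vector `h` is the limit of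
`(∫ s dE) f` for simple functions `s → φ` in `L²(μ_f)`. -/
def IsIntegral (E : ProjectionMeasure 𝓗) (φ : ℝ → ℂ) (f h : 𝓗) : Prop :=
  MemLp φ 2 (E.scalarMeasure f) ∧
    ∀ ε : ℝ, 0 < ε → ∃ s : SimpleFunc ℝ ℂ,
      eLpNorm (fun x => φ x - s x) 2 (E.scalarMeasure f) < ENNReal.ofReal ε ∧
      ‖h - E.simpleIntegral s f‖ < ε

open Classical in
/-- The vector `(∫ φ dE) f`; the value is `0` when `f` is not in the domain of `∫ φ dE`. -/
def integral (E : ProjectionMeasure 𝓗) (φ : ℝ → ℂ) (f : 𝓗) : 𝓗 :=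
  if h : ∃ g, E.IsIntegral φ f g then h.choose else 0

/-- `E` is the spectral measure of the (unbounded) operator `H`, that is, `H = ∫ λ dE_λ`,
including equality of the domains. -/
def Represents (E : ProjectionMeasure 𝓗) (H : 𝓗 →ₗ.[ℂ] 𝓗) : Prop :=
  ∀ f h : 𝓗, (f, h) ∈ H.graph ↔ E.IsIntegral (fun x => (x : ℂ)) f h

open Classical in
/-- The Dirac projection-valued measure at `0` (the spectral measure of the zero operator). -/
def dirac : ProjectionMeasure 𝓗 where
  proj B := if (0 : ℝ) ∈ B then 1 else 0
  isStarProjection B _ := by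
    split_ifs
    · exact IsStarProjection.one _
    · exact IsStarProjection.zero _
  empty := by simp
  univ := by simp
  inter A B _ _ := by
    by_cases hA : (0 : ℝ) ∈ A <;> by_cases hB : (0 : ℝ) ∈ B <;> simp [hA, hB]
  hasSum A _ hdisj f := by
    by_cases h : ∃ n, (0 : ℝ) ∈ A n
    · obtain ⟨n, hn⟩ := h
      have hU : (0 : ℝ) ∈ ⋃ n, A n := Set.mem_iUnion.2 ⟨n, hn⟩
      have := hasSum_single (f := fun m => (if (0 : ℝ) ∈ A m then (1 : 𝓗 →L[ℂ] 𝓗) else 0) f) n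
        (fun m hm => by
          have : (0 : ℝ) ∉ A m := fun h' => Set.disjoint_left.1 (hdisj hm) h' hn
          simp [this])
      simpa [hn, hU] using this
    · push Not at h
      simp [h, hasSum_zero]

end ProjectionMeasure

open Classical in
/-- The spectral measure of a self-adjoint operator `H`: the projection-valued measure `E` with
`H = ∫ λ dE_λ`, which exists and is unique on Borel sets by the spectral theorem. (For an operator
that has no spectral measure, in particular is not self-adjoint, the value is irrelevant.) -/
def spectralMeasure (H : 𝓗 →ₗ.[ℂ] 𝓗) : ProjectionMeasure 𝓗 :=
  if h : ∃ E : ProjectionMeasure 𝓗, E.Represents H then h.choose else ProjectionMeasure.dirac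

/-- The domain of the operator `φ(H)`. -/
def funcDomain (H : 𝓗 →ₗ.[ℂ] 𝓗) (φ : ℝ → ℂ) : Set 𝓗 :=
  {f | MemLp φ 2 ((spectralMeasure H).scalarMeasure f)}

/-- Borel functional calculus: `φ(H) f = ∫ φ(λ) dE_λ f`, for `f` in `funcDomain H φ`. -/
def funcCalc (H : 𝓗 →ₗ.[ℂ] 𝓗) (φ : ℝ → ℂ) (f : 𝓗) : 𝓗 :=
  (spectralMeasure H).integral φ f

/-- The function `λ ↦ ⟨λ⟩ ^ s = (1 + λ²) ^ (s / 2)`. -/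
def japanesePow (s : ℝ) (x : ℝ) : ℂ := (((1 + x ^ 2) ^ (s / 2) : ℝ) : ℂ)

/-- The unitary group `e^{-itH}`. -/
def propagator (H : 𝓗 →ₗ.[ℂ] 𝓗) (t : ℝ) (f : 𝓗) : 𝓗 :=
  funcCalc H (fun x => Complex.exp (-(Complex.I * t * x))) f

/-- The spectral projector `P_N = 1_{[N, N+1)}(H)`. -/
def spectralProjector (H : 𝓗 →ₗ.[ℂ] 𝓗) (N : ℕ) : 𝓗 →L[ℂ] 𝓗 :=
  (spectralMeasure H).proj (Set.Ico (N : ℝ) (N + 1))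

/-- `H ≥ 0` in the sense of quadratic forms. -/
def OperatorNonneg (H : 𝓗 →ₗ.[ℂ] 𝓗) : Prop :=
  ∀ f : H.domain, 0 ≤ RCLike.re (inner ℂ (f : 𝓗) (H f))

end SpectralCalculus

/-- The complex Hilbert space `L²(ℝ^d)`. -/
abbrev L2Space (d : ℕ) : Type := Lp ℂ 2 (volume : Measure (EuclideanSpace ℝ (Fin d)))

/-- `‖Ψ g‖_{L²(ℝ^d)}`, which is `∞` when the product `Ψ g` is not square integrable. -/
def weightedNorm {d : ℕ} (Ψ : EuclideanSpace ℝ (Fin d) → ℝ) (g : L2Space d) : ℝ≥0∞ :=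
  eLpNorm (fun x => (Ψ x : ℂ) * g x) 2 volume

end

open Filter Topology

noncomputable section

/-! Cutting `Ψ` off to balls replaces it by bounded multiplication operators `A`. By monotone
convergence both conditions are equivalent to bounds for these `A` with constants independent of the
radius, so it suffices to treat a bounded `A` without letting its norm enter the constants. Write φ
for the symbol of the power of ⟨H⟩.

From (i) to (ii) (`norm_apply_proj_le_of_lintegral`): on a spectral window of length one and for
times up to 1/2, the propagator is a scalar phase up to an error of norm at most 1/2. Hence ‖A g‖ is
at most ‖A e^{-isH} g‖ plus half of the norm of `A` on the window, times ‖g‖. Averaging over these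
times and applying (i) to φ(H)⁻¹ g bounds the first term; the second is absorbed, as the norm of `A`
is finite.

From (ii) to (i) (`lintegral_norm_sq_le_of_norm_apply_proj_le`): on the window at N, e^{-itx} =
e^{-itN} e^{-it(x-N)}, and the second factor is a power series in t(x-N) with 0 ≤ x-N < 1. For each
Taylor order k the sum over N is a trigonometric polynomial in t with vector coefficients, so
Parseval on [0, 2π] decouples the windows. This orthogonality is in time, so it does not matter that
`A` destroys the orthogonality of the windows in space. The weights t^k/k! make the sum over k
converge. As H ≥ 0, the windows with N ≥ 0 exhaust the spectrum. -/

theorem eLpNorm_two_sq {α F : Type*} [MeasurableSpace α] [NormedAddCommGroup F] (μ : Measure α)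
    (f : α → F) : eLpNorm f 2 μ ^ 2 = ∫⁻ x, ‖f x‖ₑ ^ 2 ∂μ := by
  have h := eLpNorm_nnreal_pow_eq_lintegral (f := f) (μ := μ) (p := 2) (by norm_num)
  have h2 : ((2 : NNReal) : ℝ) = ((2 : ℕ) : ℝ) := by norm_num
  simp only [h2, ENNReal.rpow_natCast] at h
  exact h

theorem ENNReal.sq_injective : Function.Injective fun a : ℝ≥0∞ => a ^ 2 :=
  (ENNReal.pow_right_strictMono two_ne_zero).injective

/-! ### Integration against a projection-valued measure -/

namespace ProjectionMeasure

variable {𝓗 : Type*} [NormedAddCommGroup 𝓗] [InnerProductSpace ℂ 𝓗] [CompleteSpace 𝓗]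
  (E : ProjectionMeasure 𝓗)

theorem scalarMeasure_apply (f : 𝓗) {B : Set ℝ} (hB : MeasurableSet B) :
    E.scalarMeasure f B = ‖E.proj B f‖ₑ ^ 2 := by
  rw [scalarMeasure, Measure.ofMeasurable_apply B hB, ENNReal.ofReal_pow (norm_nonneg _),
    ofReal_norm]

instance isFiniteMeasure_scalarMeasure (f : 𝓗) : IsFiniteMeasure (E.scalarMeasure f) :=
  ⟨by rw [E.scalarMeasure_apply f MeasurableSet.univ]; exact ENNReal.pow_lt_top enorm_lt_top⟩

theorem proj_union {A B : Set ℝ} (hA : MeasurableSet A) (hB : MeasurableSet B)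
    (hd : Disjoint A B) (f : 𝓗) : E.proj (A ∪ B) f = E.proj A f + E.proj B f := by
  let S : ℕ → Set ℝ := fun n => if n = 0 then A else if n = 1 then B else ∅
  have hS : ∀ n, MeasurableSet (S n) := by
    intro n; simp only [S]; split_ifs <;> simp [hA, hB]
  have hdis : Pairwise (Function.onFun Disjoint S) := by
    intro m n hmn
    simp only [Function.onFun, S]
    split_ifs <;> simp_all [disjoint_comm]
  have hU : (⋃ n, S n) = A ∪ B := by
    ext x
    simp only [Set.mem_iUnion, Set.mem_union, S]
    constructor
    · rintro ⟨n, hn⟩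
      split_ifs at hn
      · exact Or.inl hn
      · exact Or.inr hn
      · exact hn.elim
    · rintro (h | h)
      · exact ⟨0, by simpa using h⟩
      · exact ⟨1, by simpa using h⟩
  have h1 := E.hasSum S hS hdis f
  rw [hU] at h1
  have h2 := hasSum_sum_of_ne_finset_zero (L := .unconditional ℕ) (s := {0, 1})
    (f := fun n => E.proj (S n) f) (by
    intro n hn
    simp only [Finset.mem_insert, Finset.mem_singleton, not_or] at hn
    simp [S, hn.1, hn.2, E.empty])
  rw [h1.unique h2]
  simp [S]

theorem inner_proj_proj (f g : 𝓗) {A B : Set ℝ} (hA : MeasurableSet A) (hB : MeasurableSet B) :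
    inner ℂ (E.proj A f) (E.proj B g) = inner ℂ f (E.proj (A ∩ B) g) := by
  rw [E.inter A B hA hB]
  exact (E.isStarProjection A hA).isSelfAdjoint.isSymmetric f (E.proj B g)

/-- The vector-valued set function `B ↦ (c ↦ c • E(B) f)`. -/
def spanProj (f : 𝓗) (B : Set ℝ) : ℂ →L[ℝ] 𝓗 :=
  (ContinuousLinearMap.toSpanSingleton ℂ (E.proj B f)).restrictScalars ℝ

theorem spanProj_apply (f : 𝓗) (B : Set ℝ) (c : ℂ) : E.spanProj f B c = c • E.proj B f := rfl

/-- `simpleIntegral` unfolds to `SimpleFunc.setToSimpleFunc` of `spanProj`, so finite additivity is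
all that its linearity requires. -/
theorem finMeasAdditive_spanProj (f : 𝓗) : FinMeasAdditive (E.scalarMeasure f) (E.spanProj f) := by
  intro s t hs ht _ _ hd
  ext1
  simp [spanProj_apply, E.proj_union hs ht hd]

theorem integrable_simpleFunc (s : SimpleFunc ℝ ℂ) (f : 𝓗) : Integrable s (E.scalarMeasure f) :=
  s.integrable_of_isFiniteMeasure

theorem memLp_simpleFunc (s : SimpleFunc ℝ ℂ) (f : 𝓗) : MemLp s 2 (E.scalarMeasure f) :=
  s.memLp_of_isFiniteMeasure 2 _

theorem simpleIntegral_add (s r : SimpleFunc ℝ ℂ) (f : 𝓗) :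
    E.simpleIntegral (s + r) f = E.simpleIntegral s f + E.simpleIntegral r f :=
  SimpleFunc.setToSimpleFunc_add _ (E.finMeasAdditive_spanProj f) (E.integrable_simpleFunc s f)
    (E.integrable_simpleFunc r f)

theorem simpleIntegral_sub (s r : SimpleFunc ℝ ℂ) (f : 𝓗) :
    E.simpleIntegral (s - r) f = E.simpleIntegral s f - E.simpleIntegral r f :=
  SimpleFunc.setToSimpleFunc_sub _ (E.finMeasAdditive_spanProj f) (E.integrable_simpleFunc s f)
    (E.integrable_simpleFunc r f)

theorem simpleIntegral_smul (c : ℂ) (s : SimpleFunc ℝ ℂ) (f : 𝓗) :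
    E.simpleIntegral (c • s) f = c • E.simpleIntegral s f :=
  SimpleFunc.setToSimpleFunc_smul _ (E.finMeasAdditive_spanProj f)
    (fun a B x => by simp [spanProj_apply, mul_smul]) c (E.integrable_simpleFunc s f)

theorem simpleIntegral_indicator (c : ℂ) {B : Set ℝ} (hB : MeasurableSet B) (f : 𝓗) :
    E.simpleIntegral (SimpleFunc.piecewise B hB (SimpleFunc.const ℝ c) (SimpleFunc.const ℝ 0)) f
      = c • E.proj B f :=
  SimpleFunc.setToSimpleFunc_indicator (E.spanProj f)
    (by ext1; simp [spanProj_apply, E.empty]) hB c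

theorem norm_sq_simpleIntegral (s : SimpleFunc ℝ ℂ) (f : 𝓗) :
    ‖E.simpleIntegral s f‖ ^ 2 = ∑ c ∈ s.range, ‖c‖ ^ 2 * ‖E.proj (s ⁻¹' {c}) f‖ ^ 2 := by
  have horth : ∀ c ∈ s.range, ∀ d ∈ s.range, c ≠ d →
      inner ℂ (c • E.proj (s ⁻¹' {c}) f) (d • E.proj (s ⁻¹' {d}) f) = 0 := by
    intro c _ d _ hcd
    rw [inner_smul_left, inner_smul_right,
      E.inner_proj_proj f f (s.measurableSet_fiber c) (s.measurableSet_fiber d)]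
    have : (s ⁻¹' {c}) ∩ (s ⁻¹' {d}) = ∅ := by
      ext x
      simp only [Set.mem_inter_iff, Set.mem_preimage, Set.mem_singleton_iff,
        Set.mem_empty_iff_false, iff_false, not_and]
      intro h1 h2
      exact hcd (h1.symm.trans h2)
    simp [this, E.empty]
  rw [← inner_self_eq_norm_sq (𝕜 := ℂ), simpleIntegral, sum_inner]
  rw [map_sum]
  refine Finset.sum_congr rfl fun c hc => ?_
  rw [inner_sum, Finset.sum_eq_single c (fun d hd hdc => horth c hc d hd hdc.symm)
    (fun h => (h hc).elim), inner_self_eq_norm_sq, norm_smul, mul_pow]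

/-- Disjoint fibres have orthogonal projections, so Pythagoras gives an isometry from simple
functions in L²(μ_f) into the Hilbert space. Existence, uniqueness and all limits below rest on it.
-/
theorem enorm_simpleIntegral (s : SimpleFunc ℝ ℂ) (f : 𝓗) :
    ‖E.simpleIntegral s f‖ₑ = eLpNorm s 2 (E.scalarMeasure f) := by
  apply ENNReal.sq_injective
  simp only
  rw [eLpNorm_two_sq]
  have h1 : ∫⁻ x, ‖s x‖ₑ ^ 2 ∂(E.scalarMeasure f)
      = ((s.map fun c => ‖c‖ₑ ^ 2).lintegral (E.scalarMeasure f)) := by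
    rw [← SimpleFunc.lintegral_eq_lintegral]; rfl
  rw [h1, SimpleFunc.map_lintegral, ← ofReal_norm, ← ENNReal.ofReal_pow (norm_nonneg _),
    norm_sq_simpleIntegral, ENNReal.ofReal_sum_of_nonneg (fun _ _ => by positivity)]
  refine Finset.sum_congr rfl fun c _ => ?_
  rw [E.scalarMeasure_apply f (s.measurableSet_fiber c), ENNReal.ofReal_mul (by positivity),
    ENNReal.ofReal_pow (norm_nonneg _), ENNReal.ofReal_pow (norm_nonneg _), ofReal_norm,
    ofReal_norm]

variable {E}

theorem isIntegral_iff_exists_seq {φ : ℝ → ℂ} {f h : 𝓗} :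
    E.IsIntegral φ f h ↔ MemLp φ 2 (E.scalarMeasure f) ∧ ∃ s : ℕ → SimpleFunc ℝ ℂ,
      Tendsto (fun n => eLpNorm (φ - ⇑(s n)) 2 (E.scalarMeasure f)) atTop (𝓝 0) ∧
      Tendsto (fun n => E.simpleIntegral (s n) f) atTop (𝓝 h) := by
  refine and_congr_right fun hφ => ⟨fun H => ?_, ?_⟩
  · choose s hs1 hs2 using fun n : ℕ => H (1 / (n + 1)) Nat.one_div_pos_of_nat
    refine ⟨s, ?_, ?_⟩
    · refine tendsto_of_tendsto_of_tendsto_of_le_of_le tendsto_const_nhds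
        (h := fun n : ℕ => ENNReal.ofReal (1 / (n + 1))) ?_ (fun _ => zero_le) fun n => (hs1 n).le
      simpa using ENNReal.tendsto_ofReal (tendsto_one_div_add_atTop_nhds_zero_nat (𝕜 := ℝ))
    · rw [tendsto_iff_norm_sub_tendsto_zero]
      refine squeeze_zero (fun _ => norm_nonneg _) (fun n => ?_)
        (tendsto_one_div_add_atTop_nhds_zero_nat (𝕜 := ℝ))
      rw [norm_sub_rev]
      exact (hs2 n).le
  · rintro ⟨s, hs1, hs2⟩ ε hε
    have e1 := hs1.eventually_lt_const (ENNReal.ofReal_pos.2 hε)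
    rw [tendsto_iff_norm_sub_tendsto_zero] at hs2
    obtain ⟨n, hn1, hn2⟩ := (e1.and (hs2.eventually_lt_const hε)).exists
    exact ⟨s n, hn1, by rwa [norm_sub_rev]⟩

theorem tendsto_eLpNorm_of_sub {α F : Type*} [MeasurableSpace α] [NormedAddCommGroup F]
    {μ : Measure α} {φ : α → F} {s : ℕ → α → F} (hφ : MemLp φ 2 μ) (hs : ∀ n, MemLp (s n) 2 μ)
    (h : Tendsto (fun n => eLpNorm (φ - s n) 2 μ) atTop (𝓝 0)) :
    Tendsto (fun n => eLpNorm (s n) 2 μ) atTop (𝓝 (eLpNorm φ 2 μ)) := by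
  have h1 : Tendsto (fun n => (hs n).toLp) atTop (𝓝 hφ.toLp) := by
    rw [tendsto_iff_edist_tendsto_0]
    refine h.congr fun n => ?_
    rw [edist_comm, Lp.edist_toLp_toLp]
  have h2 := (continuous_enorm.tendsto _).comp h1
  simpa [Function.comp_def, Lp.enorm_toLp] using h2

theorem IsIntegral.enorm_eq {φ : ℝ → ℂ} {f h : 𝓗} (H : E.IsIntegral φ f h) :
    ‖h‖ₑ = eLpNorm φ 2 (E.scalarMeasure f) := by
  obtain ⟨hφ, s, hs1, hs2⟩ := isIntegral_iff_exists_seq.1 H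
  have h1 := tendsto_eLpNorm_of_sub hφ (fun n => E.memLp_simpleFunc (s n) f) hs1
  simp_rw [← enorm_simpleIntegral] at h1
  exact tendsto_nhds_unique ((continuous_enorm.tendsto _).comp hs2) h1

theorem isIntegral_simpleFunc (s : SimpleFunc ℝ ℂ) (f : 𝓗) :
    E.IsIntegral s f (E.simpleIntegral s f) :=
  isIntegral_iff_exists_seq.2 ⟨E.memLp_simpleFunc s f, fun _ => s, by simp, tendsto_const_nhds⟩

theorem isIntegral_indicator (c : ℂ) {B : Set ℝ} (hB : MeasurableSet B) (f : 𝓗) :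
    E.IsIntegral (B.indicator fun _ => c) f (c • E.proj B f) := by
  rw [← E.simpleIntegral_indicator c hB f]
  convert isIntegral_simpleFunc _ f using 1
  ext x
  simp [SimpleFunc.coe_piecewise, Set.indicator, Set.piecewise]

theorem IsIntegral.add {φ ψ : ℝ → ℂ} {f h k : 𝓗} (H : E.IsIntegral φ f h)
    (K : E.IsIntegral ψ f k) : E.IsIntegral (φ + ψ) f (h + k) := by
  obtain ⟨hφ, s, hs1, hs2⟩ := isIntegral_iff_exists_seq.1 H
  obtain ⟨hψ, r, hr1, hr2⟩ := isIntegral_iff_exists_seq.1 K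
  refine isIntegral_iff_exists_seq.2 ⟨hφ.add hψ, fun n => s n + r n, ?_, ?_⟩
  · refine tendsto_of_tendsto_of_tendsto_of_le_of_le tendsto_const_nhds
      (by simpa using hs1.add hr1) (fun _ => zero_le) fun n => ?_
    have : φ + ψ - ⇑(s n + r n) = (φ - ⇑(s n)) + (ψ - ⇑(r n)) := by
      rw [SimpleFunc.coe_add]; abel
    rw [this]
    exact eLpNorm_add_le (hφ.sub (E.memLp_simpleFunc _ f)).1 (hψ.sub (E.memLp_simpleFunc _ f)).1
      (by norm_num)
  · simp_rw [simpleIntegral_add]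
    exact hs2.add hr2

theorem IsIntegral.const_smul {φ : ℝ → ℂ} {f h : 𝓗} (c : ℂ) (H : E.IsIntegral φ f h) :
    E.IsIntegral (c • φ) f (c • h) := by
  obtain ⟨hφ, s, hs1, hs2⟩ := isIntegral_iff_exists_seq.1 H
  refine isIntegral_iff_exists_seq.2 ⟨hφ.const_smul c, fun n => c • s n, ?_, ?_⟩
  · have : ∀ n, eLpNorm (c • φ - ⇑(c • s n)) 2 (E.scalarMeasure f)
        = ‖c‖ₑ * eLpNorm (φ - ⇑(s n)) 2 (E.scalarMeasure f) := by
      intro n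
      rw [SimpleFunc.coe_smul, ← smul_sub, eLpNorm_const_smul]
    simp_rw [this]
    simpa using ENNReal.Tendsto.const_mul hs1 (Or.inr enorm_ne_top)
  · simp_rw [simpleIntegral_smul]
    exact hs2.const_smul c

theorem IsIntegral.sub {φ ψ : ℝ → ℂ} {f h k : 𝓗} (H : E.IsIntegral φ f h)
    (K : E.IsIntegral ψ f k) : E.IsIntegral (φ - ψ) f (h - k) := by
  simpa [sub_eq_add_neg] using H.add (K.const_smul (-1))

theorem IsIntegral.enorm_sub_eq {φ ψ : ℝ → ℂ} {f h k : 𝓗} (H : E.IsIntegral φ f h)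
    (K : E.IsIntegral ψ f k) : ‖h - k‖ₑ = eLpNorm (φ - ψ) 2 (E.scalarMeasure f) :=
  (H.sub K).enorm_eq

theorem IsIntegral.unique_of_ae_eq {φ ψ : ℝ → ℂ} {f h k : 𝓗} (H : E.IsIntegral φ f h)
    (K : E.IsIntegral ψ f k) (hφψ : φ =ᵐ[E.scalarMeasure f] ψ) : h = k := by
  have h1 := H.enorm_sub_eq K
  rw [eLpNorm_congr_ae (g := 0) (by filter_upwards [hφψ] with x hx; simp [hx]), eLpNorm_zero,
    enorm_eq_zero] at h1
  exact sub_eq_zero.1 h1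

theorem IsIntegral.unique {φ : ℝ → ℂ} {f h k : 𝓗} (H : E.IsIntegral φ f h)
    (K : E.IsIntegral φ f k) : h = k :=
  H.unique_of_ae_eq K Filter.EventuallyEq.rfl

/-- Simple functions within 2⁻ⁿ of φ have, by the isometry, integrals that form a Cauchy sequence.
-/
theorem exists_isIntegral {φ : ℝ → ℂ} {f : 𝓗} (hφ : MemLp φ 2 (E.scalarMeasure f)) :
    ∃ h, E.IsIntegral φ f h := by
  have hpos : ∀ n : ℕ, (2⁻¹ : ℝ≥0∞) ^ n ≠ 0 := fun n => by simp
  choose s hs1 hs2 using fun n : ℕ => hφ.exists_simpleFunc_eLpNorm_sub_lt (by norm_num) (hpos n)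
  have hcau : CauchySeq fun n => E.simpleIntegral (s n) f := by
    refine cauchySeq_of_edist_le_geometric 2⁻¹ 2 (by norm_num) (by norm_num) fun n => ?_
    rw [edist_eq_enorm_sub, ← simpleIntegral_sub, enorm_simpleIntegral]
    have : ⇑(s n - s (n + 1)) = (φ - ⇑(s (n + 1))) - (φ - ⇑(s n)) := by
      rw [SimpleFunc.coe_sub]; abel
    rw [this]
    refine (eLpNorm_sub_le (hφ.sub (hs2 _)).1 (hφ.sub (hs2 _)).1 (by norm_num)).trans ?_
    rw [two_mul]
    refine add_le_add ((hs1 (n + 1)).le.trans ?_) (hs1 n).le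
    exact pow_le_pow_right_of_le_one' (by norm_num) (Nat.le_succ n)
  obtain ⟨h, hh⟩ := cauchySeq_tendsto_of_complete hcau
  refine ⟨h, isIntegral_iff_exists_seq.2 ⟨hφ, s, ?_, hh⟩⟩
  refine tendsto_of_tendsto_of_tendsto_of_le_of_le tendsto_const_nhds
    (ENNReal.tendsto_pow_atTop_nhds_zero_of_lt_one (r := 2⁻¹) (by norm_num)) (fun _ => zero_le)
    fun n => (hs1 n).le

theorem isIntegral_integral {φ : ℝ → ℂ} {f : 𝓗} (hφ : MemLp φ 2 (E.scalarMeasure f)) :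
    E.IsIntegral φ f (E.integral φ f) := by
  have h := exists_isIntegral hφ
  rw [integral, dif_pos h]
  exact h.choose_spec

theorem IsIntegral.integral_eq {φ : ℝ → ℂ} {f h : 𝓗} (H : E.IsIntegral φ f h) :
    E.integral φ f = h :=
  (isIntegral_integral H.1).unique H

/-- The graph of `φ ↦ (∫ φ dE) f` is closed. -/
theorem IsIntegral.of_tendsto {ι : Type*} {l : Filter ι} [l.NeBot] {φ : ι → ℝ → ℂ} {ψ : ℝ → ℂ}
    {f k : 𝓗} {h : ι → 𝓗} (H : ∀ i, E.IsIntegral (φ i) f (h i))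
    (hψ : MemLp ψ 2 (E.scalarMeasure f))
    (hlim : Tendsto (fun i => eLpNorm (φ i - ψ) 2 (E.scalarMeasure f)) l (𝓝 0))
    (hk : Tendsto h l (𝓝 k)) : E.IsIntegral ψ f k := by
  have h1 : Tendsto h l (𝓝 (E.integral ψ f)) := by
    rw [tendsto_iff_edist_tendsto_0]
    refine hlim.congr fun i => ?_
    rw [edist_eq_enorm_sub, (H i).enorm_sub_eq (isIntegral_integral hψ)]
  rw [tendsto_nhds_unique hk h1]
  exact isIntegral_integral hψ

theorem tendsto_eLpNorm_two_of_dominated {α : Type*} [MeasurableSpace α] {μ : Measure α}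
    {ι : Type*} {l : Filter ι} [l.IsCountablyGenerated] {φ : ι → α → ℂ} {ψ : α → ℂ} {G : α → ℝ}
    (hφ : ∀ i, AEStronglyMeasurable (φ i) μ) (hψ : AEStronglyMeasurable ψ μ) (hG : MemLp G 2 μ)
    (hbd : ∀ i, ∀ᵐ x ∂μ, ‖φ i x - ψ x‖ ≤ G x)
    (hlim : ∀ᵐ x ∂μ, Tendsto (fun i => φ i x) l (𝓝 (ψ x))) :
    Tendsto (fun i => eLpNorm (φ i - ψ) 2 μ) l (𝓝 0) := by
  have key : Tendsto (fun i => ∫⁻ x, ‖φ i x - ψ x‖ₑ ^ 2 ∂μ) l (𝓝 (∫⁻ _, 0 ∂μ)) := by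
    refine tendsto_lintegral_filter_of_dominated_convergence' (fun x => ‖G x‖ₑ ^ 2)
      (Eventually.of_forall fun i => (((hφ i).sub hψ).enorm.pow_const 2))
      (Eventually.of_forall fun i => ?_) ?_ ?_
    · filter_upwards [hbd i] with x hx
      gcongr
      rw [enorm_le_iff_norm_le, Real.norm_of_nonneg ((norm_nonneg _).trans hx)]
      exact hx
    · rw [← eLpNorm_two_sq]
      exact (ENNReal.pow_lt_top hG.2).ne
    · filter_upwards [hlim] with x hx
      have := ENNReal.Tendsto.pow (n := 2) (hx.sub_const (ψ x)).enorm
      simpa using this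
  simp only [lintegral_zero] at key
  have := (ENNReal.continuous_rpow_const (y := (1 / 2 : ℝ))).tendsto 0 |>.comp key
  simp only [one_div, inv_pos, Nat.ofNat_pos, ENNReal.zero_rpow_of_pos] at this
  refine this.congr fun i => ?_
  have h2 := eLpNorm_two_sq μ (φ i - ψ)
  simp only [Pi.sub_apply] at h2
  simp only [Function.comp]
  rw [← h2, ← ENNReal.rpow_natCast, ← ENNReal.rpow_mul]
  simp

/-- Dominated convergence for the functional calculus. -/
theorem tendsto_integral_of_dominated {ι : Type*} {l : Filter ι} [l.IsCountablyGenerated]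
    {φ : ι → ℝ → ℂ} {ψ : ℝ → ℂ} {f : 𝓗} {G : ℝ → ℝ}
    (hφ : ∀ i, MemLp (φ i) 2 (E.scalarMeasure f)) (hψ : MemLp ψ 2 (E.scalarMeasure f))
    (hG : MemLp G 2 (E.scalarMeasure f))
    (hbd : ∀ i, ∀ᵐ x ∂(E.scalarMeasure f), ‖φ i x - ψ x‖ ≤ G x)
    (hlim : ∀ᵐ x ∂(E.scalarMeasure f), Tendsto (fun i => φ i x) l (𝓝 (ψ x))) :
    Tendsto (fun i => E.integral (φ i) f) l (𝓝 (E.integral ψ f)) := by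
  rw [tendsto_iff_edist_tendsto_0]
  refine (tendsto_eLpNorm_two_of_dominated (fun i => (hφ i).1) hψ.1 hG hbd hlim).congr fun i => ?_
  rw [edist_eq_enorm_sub, (isIntegral_integral (hφ i)).enorm_sub_eq (isIntegral_integral hψ)]

/-! ### Multiplicativity of the functional calculus -/

theorem IsIntegral.sum {ι : Type*} (t : Finset ι) {φ : ι → ℝ → ℂ} {f : 𝓗} {h : ι → 𝓗}
    (H : ∀ i ∈ t, E.IsIntegral (φ i) f (h i)) :
    E.IsIntegral (∑ i ∈ t, φ i) f (∑ i ∈ t, h i) := by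
  classical
  induction t using Finset.induction_on with
  | empty =>
    simpa using! isIntegral_indicator (E := E) 0 MeasurableSet.empty f
  | insert a t ha ih =>
    rw [Finset.sum_insert ha, Finset.sum_insert ha]
    exact (H a (Finset.mem_insert_self a t)).add
      (ih fun i hi => H i (Finset.mem_insert_of_mem hi))

theorem simpleFunc_eq_sum (s : SimpleFunc ℝ ℂ) :
    (s : ℝ → ℂ) = ∑ c ∈ s.range, (s ⁻¹' {c}).indicator fun _ => c := by
  ext x
  rw [Finset.sum_apply, Finset.sum_eq_single (s x)]
  · simp
  · intro c _ hc
    simp [Set.indicator, hc.symm]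
  · intro h
    exact (h (s.mem_range_self x)).elim

/-- For simple functions this is E(B)E(C) = E(B ∩ C); the general case follows because the graph is
closed. -/
theorem IsIntegral.proj {φ : ℝ → ℂ} {f h : 𝓗} (H : E.IsIntegral φ f h) {B : Set ℝ}
    (hB : MeasurableSet B) : E.IsIntegral (B.indicator φ) f (E.proj B h) := by
  have hsimple : ∀ s : SimpleFunc ℝ ℂ,
      E.IsIntegral (B.indicator s) f (E.proj B (E.simpleIntegral s f)) := by
    intro s
    have h1 : B.indicator (s : ℝ → ℂ)
        = ∑ c ∈ s.range, (B ∩ s ⁻¹' {c}).indicator fun _ => c := by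
      conv_lhs => rw [simpleFunc_eq_sum s]
      rw [Finset.indicator_sum]
      simp_rw [Set.indicator_indicator]
    rw [h1, simpleIntegral, map_sum]
    refine IsIntegral.sum _ fun c _ => ?_
    have h2 : E.proj B (c • E.proj (s ⁻¹' {c}) f) = c • E.proj (B ∩ s ⁻¹' {c}) f := by
      rw [E.inter B _ hB (s.measurableSet_fiber c), map_smul]; rfl
    rw [h2]
    exact isIntegral_indicator c (hB.inter (s.measurableSet_fiber c)) f
  obtain ⟨hφ, s, hs1, hs2⟩ := isIntegral_iff_exists_seq.1 H
  refine IsIntegral.of_tendsto (l := atTop) (fun n => hsimple (s n)) (hφ.indicator hB) ?_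
    (((E.proj B).continuous.tendsto _).comp hs2)
  refine tendsto_of_tendsto_of_tendsto_of_le_of_le tendsto_const_nhds hs1 (fun _ => zero_le)
    fun n => ?_
  rw [← Set.indicator_sub']
  refine (eLpNorm_indicator_le _).trans (le_of_eq ?_)
  rw [eLpNorm_sub_comm]

/-- The isometry applied to E(B)h. It identifies L² norms for μ_h with weighted ones for μ_f, which
is what composing two symbols needs. -/
theorem IsIntegral.scalarMeasure_eq {φ : ℝ → ℂ} {f h : 𝓗} (H : E.IsIntegral φ f h) :
    E.scalarMeasure h = (E.scalarMeasure f).withDensity fun x => ‖φ x‖ₑ ^ 2 := by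
  ext B hB
  rw [E.scalarMeasure_apply h hB, (H.proj hB).enorm_eq, eLpNorm_two_sq, withDensity_apply _ hB,
    ← lintegral_indicator hB]
  congr 1
  ext x
  by_cases hx : x ∈ B <;> simp [hx]

theorem IsIntegral.eLpNorm_scalarMeasure {φ ψ : ℝ → ℂ} {f h : 𝓗} (H : E.IsIntegral φ f h)
    (hφ : Measurable φ) (hψ : Measurable ψ) :
    eLpNorm ψ 2 (E.scalarMeasure h) = eLpNorm (ψ * φ) 2 (E.scalarMeasure f) := by
  apply ENNReal.sq_injective
  simp only
  rw [eLpNorm_two_sq, eLpNorm_two_sq,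
    H.scalarMeasure_eq, lintegral_withDensity_eq_lintegral_mul _ (by fun_prop) (by fun_prop)]
  congr 1
  ext x
  simp [mul_pow, mul_comm]

theorem IsIntegral.simpleIntegral {φ : ℝ → ℂ} {f h : 𝓗} (H : E.IsIntegral φ f h)
    (s : SimpleFunc ℝ ℂ) : E.IsIntegral (s * φ) f (E.simpleIntegral s h) := by
  have h1 : (s : ℝ → ℂ) * φ = ∑ c ∈ s.range, c • (s ⁻¹' {c}).indicator φ := by
    conv_lhs => rw [simpleFunc_eq_sum s, Finset.sum_mul]
    refine Finset.sum_congr rfl fun c _ => ?_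
    ext x
    simp only [Pi.mul_apply, Pi.smul_apply, Set.indicator]
    split_ifs <;> simp
  rw [h1]
  exact IsIntegral.sum _ fun c _ => (H.proj (s.measurableSet_fiber c)).const_smul c

/-- Simple functions tending to ψ in L²(μ_h) tend to ψφ in L²(μ_f) after multiplication by φ, so the
product rule passes from simple symbols to the limit. -/
theorem IsIntegral.comp {φ ψ : ℝ → ℂ} {f h : 𝓗} (H : E.IsIntegral φ f h) (hφ : Measurable φ)
    (hψ : Measurable ψ) (hψφ : MemLp (ψ * φ) 2 (E.scalarMeasure f)) :
    E.IsIntegral ψ h (E.integral (ψ * φ) f) := by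
  have hψh : MemLp ψ 2 (E.scalarMeasure h) :=
    ⟨hψ.aestronglyMeasurable, by rw [H.eLpNorm_scalarMeasure hφ hψ]; exact hψφ.2⟩
  have K := isIntegral_integral hψh
  obtain ⟨-, s, hs1, hs2⟩ := isIntegral_iff_exists_seq.1 K
  have h1 : E.IsIntegral (ψ * φ) f (E.integral ψ h) := by
    refine IsIntegral.of_tendsto (l := atTop) (fun n => H.simpleIntegral (s n)) hψφ ?_ hs2
    refine hs1.congr fun n => ?_
    rw [H.eLpNorm_scalarMeasure hφ (hψ.sub (s n).measurable), sub_mul, eLpNorm_sub_comm]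
  rwa [h1.integral_eq]

theorem integral_integral {φ ψ : ℝ → ℂ} {f : 𝓗} (hφ : Measurable φ)
    (hψ : Measurable ψ) (hφf : MemLp φ 2 (E.scalarMeasure f))
    (hψφ : MemLp (ψ * φ) 2 (E.scalarMeasure f)) :
    E.integral ψ (E.integral φ f) = E.integral (ψ * φ) f :=
  ((isIntegral_integral hφf).comp hφ hψ hψφ).integral_eq

theorem proj_integral {φ : ℝ → ℂ} {f : 𝓗} (hφ : MemLp φ 2 (E.scalarMeasure f)) {B : Set ℝ}
    (hB : MeasurableSet B) : E.proj B (E.integral φ f) = E.integral (B.indicator φ) f :=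
  ((isIntegral_integral hφ).proj hB).integral_eq.symm

theorem isIntegral_one (f : 𝓗) : E.IsIntegral 1 f f := by
  have := isIntegral_indicator (E := E) 1 MeasurableSet.univ f
  rw [E.univ] at this
  simpa [Pi.one_def] using this

theorem scalarMeasure_proj (f : 𝓗) {B : Set ℝ} (hB : MeasurableSet B) :
    E.scalarMeasure (E.proj B f) = (E.scalarMeasure f).restrict B := by
  rw [((isIntegral_one (E := E) f).proj hB).scalarMeasure_eq, ← withDensity_indicator_one hB]
  congr 1
  ext x
  by_cases hx : x ∈ B <;> simp [hx]

theorem proj_eq_zero_of_null {f : 𝓗} {B : Set ℝ} (hB : MeasurableSet B)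
    (h : E.scalarMeasure f B = 0) : E.proj B f = 0 := by
  rw [E.scalarMeasure_apply f hB] at h
  simpa using h

end ProjectionMeasure

/-! ### Parseval's identity on [0, 2π] -/

theorem integral_exp_I_mul_sub_nat (N M : ℕ) :
    ∫ t in (0 : ℝ)..(2 * Real.pi), Complex.exp (Complex.I * (N - M : ℂ) * t)
      = if N = M then 2 * (Real.pi : ℂ) else 0 := by
  split_ifs with h
  · subst h
    simp
  · have hc : Complex.I * (N - M : ℂ) ≠ 0 := by
      refine mul_ne_zero Complex.I_ne_zero (sub_ne_zero.2 ?_)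
      exact_mod_cast h
    rw [integral_exp_mul_complex hc]
    have : Complex.exp (Complex.I * (N - M : ℂ) * ((2 * Real.pi : ℝ) : ℂ)) = 1 := by
      have := Complex.exp_int_mul_two_pi_mul_I ((N : ℤ) - M)
      rw [← this]
      congr 1
      push_cast
      ring
    rw [this]
    simp

/-- Parseval's identity for trigonometric polynomials with coefficients in a Hilbert space. -/
theorem integral_norm_sq_trigPoly {𝓗 : Type*} [NormedAddCommGroup 𝓗] [InnerProductSpace ℂ 𝓗]
    (n : ℕ) (v : ℕ → 𝓗) :
    ∫ t in (0 : ℝ)..(2 * Real.pi),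
        ‖∑ N ∈ Finset.range n, Complex.exp (-(Complex.I * t * N)) • v N‖ ^ 2
      = 2 * Real.pi * ∑ N ∈ Finset.range n, ‖v N‖ ^ 2 := by
  have key : ∀ t : ℝ,
      ((‖∑ N ∈ Finset.range n, Complex.exp (-(Complex.I * t * N)) • v N‖ ^ 2 : ℝ) : ℂ)
      = ∑ N ∈ Finset.range n, ∑ M ∈ Finset.range n,
        Complex.exp (Complex.I * (N - M : ℂ) * t) * inner ℂ (v N) (v M) := by
    intro t
    have h1 := inner_self_eq_norm_sq_to_K (𝕜 := ℂ)
      (∑ N ∈ Finset.range n, Complex.exp (-(Complex.I * t * N)) • v N)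
    rw [Complex.ofReal_pow]
    refine h1.symm.trans ?_
    rw [sum_inner]
    refine Finset.sum_congr rfl fun N _ => ?_
    rw [inner_sum]
    refine Finset.sum_congr rfl fun M _ => ?_
    rw [inner_smul_left, inner_smul_right, ← mul_assoc, ← Complex.exp_conj, ← Complex.exp_add]
    congr 2
    simp only [map_neg, map_mul, Complex.conj_I, Complex.conj_ofReal, Complex.conj_natCast]
    ring
  apply Complex.ofReal_injective
  rw [← intervalIntegral.integral_ofReal]
  simp_rw [key]
  rw [intervalIntegral.integral_finsetSum
    (fun N _ => Continuous.intervalIntegrable (by fun_prop) _ _)]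
  have : ∀ N ∈ Finset.range n, ∫ t in (0 : ℝ)..(2 * Real.pi), ∑ M ∈ Finset.range n,
      Complex.exp (Complex.I * (N - M : ℂ) * t) * inner ℂ (v N) (v M)
      = 2 * Real.pi * (‖v N‖ ^ 2 : ℝ) := by
    intro N hN
    rw [intervalIntegral.integral_finsetSum
      (fun N _ => Continuous.intervalIntegrable (by fun_prop) _ _)]
    simp_rw [intervalIntegral.integral_mul_const, integral_exp_I_mul_sub_nat, ite_mul, zero_mul]
    rw [Finset.sum_ite_eq, if_pos hN]
    congr 1
    exact (inner_self_eq_norm_sq_to_K (𝕜 := ℂ) (v N)).trans (by simp)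
  rw [Finset.sum_congr rfl this]
  push_cast
  rw [Finset.mul_sum]

/-! ### Spectral windows and the support of the spectral measure -/

namespace ProjectionMeasure

variable {𝓗 : Type*} [NormedAddCommGroup 𝓗] [InnerProductSpace ℂ 𝓗] [CompleteSpace 𝓗]
  {E : ProjectionMeasure 𝓗}

theorem proj_proj_self {B : Set ℝ} (hB : MeasurableSet B) (f : 𝓗) :
    E.proj B (E.proj B f) = E.proj B f := by
  have := (E.isStarProjection B hB).isIdempotentElem
  exact congrArg (fun T : 𝓗 →L[ℂ] 𝓗 => T f) this

theorem norm_proj_le {B : Set ℝ} (hB : MeasurableSet B) (f : 𝓗) : ‖E.proj B f‖ ≤ ‖f‖ := by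
  have h1 := E.scalarMeasure_apply f hB
  have h2 := E.scalarMeasure_apply f MeasurableSet.univ
  rw [E.univ] at h2
  have h3 : ‖E.proj B f‖ₑ ^ 2 ≤ ‖f‖ₑ ^ 2 := by
    rw [← h1]
    exact (measure_mono (Set.subset_univ B)).trans h2.le
  exact enorm_le_iff_norm_le.1 ((ENNReal.pow_le_pow_left_iff two_ne_zero).1 h3)

theorem IsIntegral.norm_le_of_le {φ ψ : ℝ → ℂ} {f h k : 𝓗} (H : E.IsIntegral φ f h)
    (K : E.IsIntegral ψ f k) (hle : ∀ x, ‖φ x‖ ≤ ‖ψ x‖) : ‖h‖ ≤ ‖k‖ := by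
  rw [← enorm_le_iff_norm_le, H.enorm_eq, K.enorm_eq]
  exact eLpNorm_mono hle

theorem mem_Ico_iff_floor_eq {x : ℝ} (hx : 0 ≤ x) (N : ℕ) :
    x ∈ Set.Ico (N : ℝ) (N + 1) ↔ ⌊x⌋₊ = N :=
  (Nat.floor_eq_iff hx).symm

theorem pairwise_disjoint_Ico_nat_add_one {N M : ℕ} (h : N ≠ M) :
    Disjoint (Set.Ico (N : ℝ) (N + 1)) (Set.Ico (M : ℝ) (M + 1)) := by
  refine Set.disjoint_left.2 fun x hN hM => h ?_
  have hx : 0 ≤ x := (Nat.cast_nonneg N).trans hN.1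
  rw [mem_Ico_iff_floor_eq hx] at hN hM
  exact hN.symm.trans hM

theorem sum_norm_sq_proj_le (f : 𝓗) (n : ℕ) :
    ∑ N ∈ Finset.range n, ‖E.proj (Set.Ico (N : ℝ) (N + 1)) f‖ ^ 2 ≤ ‖f‖ ^ 2 := by
  have h1 : ∑ N ∈ Finset.range n, E.scalarMeasure f (Set.Ico (N : ℝ) (N + 1))
      ≤ E.scalarMeasure f Set.univ := by
    refine sum_measure_le_measure_univ (fun N _ => measurableSet_Ico.nullMeasurableSet) ?_
    intro N _ M _ hNM
    have := pairwise_disjoint_Ico_nat_add_one hNM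
    exact this.aedisjoint
  rw [E.scalarMeasure_apply f MeasurableSet.univ, E.univ] at h1
  simp_rw [E.scalarMeasure_apply f measurableSet_Ico, ← ofReal_norm,
    ← ENNReal.ofReal_pow (norm_nonneg _)] at h1
  rw [← ENNReal.ofReal_sum_of_nonneg (fun _ _ => by positivity),
    ENNReal.ofReal_le_ofReal_iff (by positivity)] at h1
  exact h1

/-- The vector f = E([a,b])g lies in the domain because x is bounded on [a,b]. Nonnegativity gives
‖Hf + f‖² ≥ ‖Hf‖² + ‖f‖², whereas (x+1)² ≤ x² + 1 + 2b on [a,b] gives the reverse inequality with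
the extra negative term 2b‖f‖². Comparing norms lets the isometry alone suffice, without an integral
formula for the inner product. -/
theorem proj_eq_zero_of_represents {H : 𝓗 →ₗ.[ℂ] 𝓗} (hE : E.Represents H)
    (hpos : OperatorNonneg H) {a b : ℝ} (hb : b < 0) (g : 𝓗) : E.proj (Set.Icc a b) g = 0 := by
  set B := Set.Icc a b
  have hB : MeasurableSet B := measurableSet_Icc
  set f := E.proj B g with hf
  have hμ : ∀ᵐ x ∂(E.scalarMeasure f), x ∈ B := by
    rw [hf, scalarMeasure_proj g hB]
    exact ae_restrict_mem hB
  have hid : MemLp (fun x : ℝ => (x : ℂ)) 2 (E.scalarMeasure f) := by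
    refine MemLp.of_bound Complex.measurable_ofReal.aestronglyMeasurable (max |a| |b|) ?_
    filter_upwards [hμ] with x hx
    rw [Complex.norm_real]
    exact abs_le_max_abs_abs hx.1 hx.2
  obtain ⟨h, hh⟩ := exists_isIntegral hid
  have hgraph := (hE f h).2 hh
  obtain ⟨y, hy1, hy2⟩ := (LinearPMap.mem_graph_iff H).1 hgraph
  have hip := hpos y
  rw [hy1, hy2] at hip
  have hsq : ‖h‖ ^ 2 + ‖f‖ ^ 2 ≤ ‖h + f‖ ^ 2 := by
    have := norm_add_sq (𝕜 := ℂ) h f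
    rw [inner_re_symm] at this
    linarith
  have hone := isIntegral_one (E := E) f
  have e1 : ∀ {φ : ℝ → ℂ} {k : 𝓗}, E.IsIntegral φ f k →
      ENNReal.ofReal (‖k‖ ^ 2) = ∫⁻ x, ENNReal.ofReal (‖φ x‖ ^ 2) ∂(E.scalarMeasure f) := by
    intro φ k hk
    rw [ENNReal.ofReal_pow (norm_nonneg _), ofReal_norm, hk.enorm_eq, eLpNorm_two_sq]
    simp_rw [ENNReal.ofReal_pow (norm_nonneg _), ofReal_norm]
  have e2 : ∫⁻ x, ENNReal.ofReal (‖((fun x : ℝ => (x : ℂ)) + 1) x‖ ^ 2) ∂(E.scalarMeasure f)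
      + ENNReal.ofReal (2 * -b) * ∫⁻ x, ENNReal.ofReal (‖(1 : ℝ → ℂ) x‖ ^ 2) ∂(E.scalarMeasure f)
      ≤ ∫⁻ x, ENNReal.ofReal (‖(x : ℂ)‖ ^ 2) ∂(E.scalarMeasure f)
        + ∫⁻ x, ENNReal.ofReal (‖(1 : ℝ → ℂ) x‖ ^ 2) ∂(E.scalarMeasure f) := by
    rw [← lintegral_const_mul _ (by fun_prop), ← lintegral_add_left (by fun_prop),
      ← lintegral_add_left (by fun_prop)]
    refine lintegral_mono_ae ?_
    filter_upwards [hμ] with x hx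
    rw [← ENNReal.ofReal_mul (by linarith), ← ENNReal.ofReal_add (by positivity)
      (mul_nonneg (by linarith) (by positivity)), ← ENNReal.ofReal_add (by positivity)
      (by positivity)]
    refine ENNReal.ofReal_le_ofReal ?_
    have hx2 : ((fun x : ℝ => (x : ℂ)) + 1) x = ((x + 1 : ℝ) : ℂ) := by simp
    rw [hx2, Complex.norm_real, Complex.norm_real, Real.norm_eq_abs, Real.norm_eq_abs, sq_abs,
      sq_abs]
    have := hx.2
    simp only [Pi.one_apply, norm_one]
    nlinarith
  rw [← e1 (hh.add hone), ← e1 hh, ← e1 hone, ← ENNReal.ofReal_mul (by linarith),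
    ← ENNReal.ofReal_add (by positivity) (mul_nonneg (by linarith) (by positivity)),
    ← ENNReal.ofReal_add (by positivity) (by positivity),
    ENNReal.ofReal_le_ofReal_iff (by positivity)] at e2
  have h0 : -b * ‖f‖ ^ 2 ≤ 0 := by nlinarith
  have h1 : ‖f‖ ^ 2 ≤ 0 := by
    by_contra hc
    push Not at hc
    have := mul_pos (neg_pos.2 hb) hc
    linarith
  exact norm_eq_zero.1 (pow_eq_zero_iff two_ne_zero |>.1 (le_antisymm h1 (by positivity)))

/-- The spectral measure of a nonnegative operator is supported in `[0, ∞)`. -/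
theorem proj_Iio_zero_of_represents {H : 𝓗 →ₗ.[ℂ] 𝓗} (hE : E.Represents H)
    (hpos : OperatorNonneg H) (f : 𝓗) : E.proj (Set.Iio 0) f = 0 := by
  refine proj_eq_zero_of_null measurableSet_Iio ?_
  refine measure_mono_null (t := ⋃ n : ℕ, Set.Icc (-(n : ℝ)) (-(1 / (n + 1)))) ?_ ?_
  · intro x hx
    have hx' : x < 0 := hx
    obtain ⟨n, hn⟩ := exists_nat_one_div_lt (neg_pos.2 hx')
    obtain ⟨m, hm⟩ := exists_nat_ge (-x)
    refine Set.mem_iUnion.2 ⟨max n m, ?_, ?_⟩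
    · have : (m : ℝ) ≤ (max n m : ℕ) := by exact_mod_cast le_max_right n m
      linarith
    · have h1 : (n : ℝ) ≤ (max n m : ℕ) := by exact_mod_cast le_max_left n m
      have h2 : 1 / (((max n m : ℕ) : ℝ) + 1) ≤ 1 / ((n : ℝ) + 1) := by gcongr
      linarith
  · refine measure_iUnion_null fun n => ?_
    rw [E.scalarMeasure_apply f measurableSet_Icc, proj_eq_zero_of_represents hE hpos
      (neg_lt_zero.2 Nat.one_div_pos_of_nat)]
    simp

theorem ae_nonneg_of_proj_Iio {f : 𝓗} (h : E.proj (Set.Iio 0) f = 0) :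
    ∀ᵐ x ∂(E.scalarMeasure f), 0 ≤ x := by
  have : E.scalarMeasure f (Set.Iio 0) = 0 := by
    rw [E.scalarMeasure_apply f measurableSet_Iio, h]; simp
  rw [ae_iff]
  simpa [Set.Iio] using this

/-! ### The propagator -/

/-- The symbol `x ↦ e^{-itx}` of the propagator. -/
def phase (t x : ℝ) : ℂ := Complex.exp (-(Complex.I * t * x))

theorem measurable_phase (t : ℝ) : Measurable (phase t) := by
  unfold phase; fun_prop

theorem norm_phase (t x : ℝ) : ‖phase t x‖ = 1 := by
  have : -(Complex.I * t * x) = ((-(t * x) : ℝ) : ℂ) * Complex.I := by push_cast; ring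
  rw [phase, this, Complex.norm_exp_ofReal_mul_I]

theorem memLp_phase (t : ℝ) (f : 𝓗) : MemLp (phase t) 2 (E.scalarMeasure f) :=
  MemLp.of_bound (measurable_phase t).aestronglyMeasurable 1
    (Eventually.of_forall fun x => (norm_phase t x).le)

theorem memLp_mul_phase {φ : ℝ → ℂ} {f : 𝓗} (hφ : MemLp φ 2 (E.scalarMeasure f)) (t : ℝ) :
    MemLp (φ * phase t) 2 (E.scalarMeasure f) :=
  hφ.of_le (hφ.1.mul (measurable_phase t).aestronglyMeasurable)
    (Eventually.of_forall fun x => by simp [norm_phase])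

/-- Supplies the measurability in time that monotone convergence over the cutoff radius requires. -/
theorem continuous_integral_mul_phase {φ : ℝ → ℂ} {f : 𝓗}
    (hφ : MemLp φ 2 (E.scalarMeasure f)) :
    Continuous fun t : ℝ => E.integral (φ * phase t) f := by
  refine continuous_iff_continuousAt.2 fun t => ?_
  refine tendsto_integral_of_dominated (fun s => memLp_mul_phase hφ s) (memLp_mul_phase hφ t)
    (G := fun x => 2 * ‖φ x‖) (hφ.norm.const_mul 2)
    (fun s => Eventually.of_forall fun x => ?_) (Eventually.of_forall fun x => ?_)
  · refine (norm_sub_le _ _).trans (le_of_eq ?_)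
    simp only [Pi.mul_apply, norm_mul, norm_phase]
    ring
  · have : Continuous fun s : ℝ => (φ * phase s) x := by
      simp only [Pi.mul_apply, phase]; fun_prop
    exact this.tendsto t

/-! ### From the time average to spectral windows -/

/-- A time-averaged bound for `A φ(H) e^{-itH}` gives a bound for `A` on spectral windows. -/
theorem norm_apply_proj_le_of_lintegral {φ : ℝ → ℂ} (hφ : Measurable φ) (A : 𝓗 →L[ℂ] 𝓗) {C : ℝ}
    (hC : 0 ≤ C)
    (hA : ∀ f, MemLp φ 2 (E.scalarMeasure f) →
      ∫⁻ t in Set.Ioc (0 : ℝ) (2 * Real.pi), ‖A (E.integral (φ * phase t) f)‖ₑ ^ 2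
        ≤ ENNReal.ofReal (C * ‖f‖) ^ 2)
    {a b : ℝ} (hb : 0 < b) (hbφ : ∀ x ∈ Set.Ico a (a + 1), b ≤ ‖φ x‖) (f : 𝓗) :
    ‖A (E.proj (Set.Ico a (a + 1)) f)‖ ≤ 4 * C / b * ‖E.proj (Set.Ico a (a + 1)) f‖ := by
  set B := Set.Ico a (a + 1)
  have hB : MeasurableSet B := measurableSet_Ico
  -- Finite because `A` is bounded; this is what permits absorbing β/2 at the end.
  set β := ‖A ∘L E.proj B‖ with hβ
  have hβA : ∀ y, E.proj B y = y → ‖A y‖ ≤ β * ‖y‖ := by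
    intro y hy
    have := (A ∘L E.proj B).le_opNorm y
    rwa [ContinuousLinearMap.comp_apply, hy] at this
  have step : ∀ g, E.proj B g = g → ‖A g‖ ≤ (β / 2 + 2 * C / b) * ‖g‖ := by
    intro g hg
    have hInv : MemLp (B.indicator φ⁻¹) 2 (E.scalarMeasure g) := by
      refine MemLp.of_bound (hφ.inv.indicator hB).aestronglyMeasurable b⁻¹
        (Eventually.of_forall fun x => ?_)
      by_cases hx : x ∈ B
      · simp only [Set.indicator_of_mem hx, Pi.inv_apply, norm_inv]
        exact inv_anti₀ hb (hbφ x hx)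
      · simp only [Set.indicator_of_notMem hx, norm_zero]
        positivity
    -- With this choice φ(H)e^{-isH}h = e^{-isH}g, and ‖h‖ ≤ ‖g‖/b since |φ| ≥ b on the window.
    set h := E.integral (B.indicator φ⁻¹) g with hh
    have hInt : E.IsIntegral (B.indicator φ⁻¹) g h := isIntegral_integral hInv
    have hcancel : ∀ s, φ * phase s * B.indicator φ⁻¹ = B.indicator (phase s) := by
      intro s
      ext x
      by_cases hx : x ∈ B
      · have : φ x ≠ 0 := norm_pos_iff.1 (hb.trans_le (hbφ x hx))
        simp only [Pi.mul_apply, Set.indicator_of_mem hx, Pi.inv_apply]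
        field_simp
      · simp [hx]
    have hMem : MemLp φ 2 (E.scalarMeasure h) := by
      refine ⟨hφ.aestronglyMeasurable, ?_⟩
      rw [hInt.eLpNorm_scalarMeasure (hφ.inv.indicator hB) hφ]
      refine (eLpNorm_mono (g := (1 : ℝ → ℂ)) fun x => ?_).trans_lt (isIntegral_one g).1.2
      by_cases hx : x ∈ B
      · have : φ x ≠ 0 := norm_pos_iff.1 (hb.trans_le (hbφ x hx))
        simp [hx, this]
      · simp [hx]
    have hnorm_h : ‖h‖ ≤ b⁻¹ * ‖g‖ := by
      have := hInt.norm_le_of_le ((isIntegral_one g).const_smul ((b⁻¹ : ℝ) : ℂ)) fun x => ?_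
      · rwa [norm_smul, Complex.norm_real, Real.norm_of_nonneg (by positivity)] at this
      · simp only [Pi.smul_apply, Pi.one_apply, smul_eq_mul, mul_one, Complex.norm_real]
        rw [Real.norm_of_nonneg (by positivity)]
        by_cases hx : x ∈ B
        · simp only [Set.indicator_of_mem hx, Pi.inv_apply, norm_inv]
          exact inv_anti₀ hb (hbφ x hx)
        · simp only [Set.indicator_of_notMem hx, norm_zero]
          positivity
    -- On the window |e^{isa}e^{-isx} - 1| ≤ s(x - a) ≤ 1/2. So g differs from e^{isa}e^{-isH}g by a
    -- vector of the window of norm at most ‖g‖/2, on which `A` costs a factor β.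
    have hlow : ∀ s ∈ Set.Ioc (0 : ℝ) (1 / 2),
        ‖A g‖ - β / 2 * ‖g‖ ≤ ‖A (E.integral (φ * phase s) h)‖ := by
      intro s hs
      have hφs : Measurable (φ * phase s) := hφ.mul (measurable_phase s)
      have hy : E.integral (φ * phase s) h = E.integral (B.indicator (phase s)) g := by
        rw [hh, integral_integral (hφ.inv.indicator hB) hφs hInv, hcancel]
        rw [hcancel]
        exact (memLp_phase s g).indicator hB
      have hy2 := isIntegral_integral ((memLp_phase (E := E) s g).indicator hB)
      rw [hy]
      set y := E.integral (B.indicator (phase s)) g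
      set c := Complex.exp (Complex.I * s * a) with hc
      have hcn : ‖c‖ = 1 := by
        have : Complex.I * s * a = ((s * a : ℝ) : ℂ) * Complex.I := by push_cast; ring
        rw [hc, this, Complex.norm_exp_ofReal_mul_I]
      have hg1 := (isIntegral_one (E := E) g).proj hB
      rw [hg] at hg1
      have hz := hg1.sub (hy2.const_smul c)
      have hzB : E.proj B (g - c • y) = g - c • y := by
        have h2 := hz.proj hB
        refine h2.unique ?_
        convert hz using 1
        ext x
        by_cases hx : x ∈ B <;> simp [hx]
      have hzn : ‖g - c • y‖ ≤ 1 / 2 * ‖g‖ := by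
        have := hz.norm_le_of_le ((isIntegral_one g).const_smul ((1 / 2 : ℝ) : ℂ)) fun x => ?_
        · rwa [norm_smul, Complex.norm_real, Real.norm_of_nonneg (by positivity)] at this
        · simp only [Pi.smul_apply, Pi.one_apply, smul_eq_mul, mul_one, Complex.norm_real,
            Pi.sub_apply]
          rw [Real.norm_of_nonneg (by positivity)]
          by_cases hx : x ∈ B
          · simp only [Set.indicator_of_mem hx, Pi.one_apply, hc, phase, ← Complex.exp_add]
            have h3 := Real.norm_exp_I_mul_ofReal_sub_one_le (x := -(s * (x - a)))
            rw [norm_sub_rev]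
            have h4 : Complex.I * s * a + -(Complex.I * s * x)
                = Complex.I * ((-(s * (x - a)) : ℝ) : ℂ) := by push_cast; ring
            rw [h4]
            refine h3.trans ?_
            rw [norm_neg, Real.norm_of_nonneg (mul_nonneg hs.1.le (sub_nonneg.2 hx.1))]
            have := hx.1
            have := hx.2
            have := hs.1
            have := hs.2
            nlinarith
          · simp [hx]
      have h5 : A g = A (c • y) + A (g - c • y) := by rw [← map_add]; congr 1; abel
      have h6 : ‖A (c • y)‖ = ‖A y‖ := by rw [map_smul, norm_smul, hcn, one_mul]
      have h7 := hβA _ hzB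
      have h8 : ‖A g‖ ≤ ‖A y‖ + ‖A (g - c • y)‖ := by
        rw [← h6]
        conv_lhs => rw [h5]
        exact norm_add_le _ _
      have h9 : β * ‖g - c • y‖ ≤ β * (1 / 2 * ‖g‖) := by gcongr
      linarith
    set D := ‖A g‖ - β / 2 * ‖g‖ with hD
    -- Integrating over (0, 1/2] gives D²/2 ≤ (C‖h‖)²; the factor 2 is a crude √2.
    have hDle : D ≤ 2 * (C * ‖h‖) := by
      rcases le_or_gt D 0 with h0 | h0
      · exact h0.trans (by positivity)
      have hsub : Set.Ioc (0 : ℝ) (1 / 2) ⊆ Set.Ioc 0 (2 * Real.pi) :=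
        Set.Ioc_subset_Ioc_right (by linarith [Real.pi_gt_three])
      have h1 : ENNReal.ofReal D ^ 2 * ENNReal.ofReal (1 / 2) ≤ ENNReal.ofReal (C * ‖h‖) ^ 2 := by
        refine le_trans ?_ (hA h hMem)
        refine le_trans ?_ (lintegral_mono_set hsub)
        have : ENNReal.ofReal D ^ 2 * ENNReal.ofReal (1 / 2)
            = ∫⁻ _ in Set.Ioc (0 : ℝ) (1 / 2), ENNReal.ofReal D ^ 2 := by
          rw [setLIntegral_const, Real.volume_Ioc, sub_zero]
        rw [this]
        refine setLIntegral_mono' measurableSet_Ioc fun s hs => ?_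
        gcongr
        rw [← ofReal_norm]
        exact ENNReal.ofReal_le_ofReal (hlow s hs)
      rw [← ENNReal.ofReal_pow h0.le, ← ENNReal.ofReal_pow (by positivity),
        ← ENNReal.ofReal_mul (by positivity), ENNReal.ofReal_le_ofReal_iff (by positivity)] at h1
      refine le_of_sq_le_sq ?_ (by positivity)
      nlinarith [sq_nonneg (C * ‖h‖)]
    have : C * ‖h‖ ≤ C * (b⁻¹ * ‖g‖) := by gcongr
    have h10 : 2 * C / b * ‖g‖ = 2 * (C * (b⁻¹ * ‖g‖)) := by field_simp
    rw [add_mul, h10]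
    linarith
  have hβle : β ≤ β / 2 + 2 * C / b := by
    refine ContinuousLinearMap.opNorm_le_bound _ (by positivity) fun x => ?_
    refine (step _ (proj_proj_self hB x)).trans ?_
    gcongr
    exact norm_proj_le hB x
  have hβ4 : β ≤ 4 * C / b := by
    have : 4 * C / b = 2 * (2 * C / b) := by ring
    linarith
  refine (hβA _ (proj_proj_self hB f)).trans ?_
  gcongr

/-! ### From spectral windows to the time average -/

/-- The function `φ(x) (x - N)^k` cut off to the window `[N, N + 1)`. -/
def windowMoment (φ : ℝ → ℂ) (N k : ℕ) : ℝ → ℂ :=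
  (Set.Ico (N : ℝ) (N + 1)).indicator fun x => φ x * ((x : ℂ) - N) ^ k

theorem norm_windowMoment_le (φ : ℝ → ℂ) (N k : ℕ) (x : ℝ) : ‖windowMoment φ N k x‖ ≤ ‖φ x‖ := by
  by_cases hx : x ∈ Set.Ico (N : ℝ) (N + 1)
  · rw [windowMoment, Set.indicator_of_mem hx, norm_mul, norm_pow]
    have : ‖(x : ℂ) - N‖ ≤ 1 := by
      have h1 : (x : ℂ) - N = ((x - N : ℝ) : ℂ) := by push_cast; ring
      rw [h1, Complex.norm_real, Real.norm_of_nonneg (sub_nonneg.2 hx.1)]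
      linarith [hx.2]
    exact mul_le_of_le_one_right (norm_nonneg _) (pow_le_one₀ (norm_nonneg _) this)
  · rw [windowMoment, Set.indicator_of_notMem hx, norm_zero]
    positivity

theorem memLp_windowMoment {φ : ℝ → ℂ} (hφ : Measurable φ) {f : 𝓗}
    (hf : MemLp φ 2 (E.scalarMeasure f)) (N k : ℕ) :
    MemLp (windowMoment φ N k) 2 (E.scalarMeasure f) := by
  refine hf.of_le ?_ (Eventually.of_forall (norm_windowMoment_le φ N k))
  refine (Measurable.indicator ?_ measurableSet_Ico).aestronglyMeasurable
  fun_prop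

/-- The moment vector stays in the range of the window projection, so the bound on `A` applies to
it; |x - N| ≤ 1 makes the result uniform in k. -/
theorem norm_apply_windowMoment_le {φ : ℝ → ℂ} (hφ : Measurable φ) (A : 𝓗 →L[ℂ] 𝓗) {N : ℕ}
    {b K : ℝ} (hb : 0 ≤ b) (hK : 0 ≤ K)
    (hA : ∀ f, ‖A (E.proj (Set.Ico (N : ℝ) (N + 1)) f)‖
      ≤ b * ‖E.proj (Set.Ico (N : ℝ) (N + 1)) f‖)
    (hbK : ∀ x ∈ Set.Ico (N : ℝ) (N + 1), b * ‖φ x‖ ≤ K) {f : 𝓗}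
    (hf : MemLp φ 2 (E.scalarMeasure f)) (k : ℕ) :
    ‖A (E.integral (windowMoment φ N k) f)‖ ≤ K * ‖E.proj (Set.Ico (N : ℝ) (N + 1)) f‖ := by
  have hm := memLp_windowMoment hφ hf N k
  have hI := isIntegral_integral hm
  have h1 : E.proj (Set.Ico (N : ℝ) (N + 1)) (E.integral (windowMoment φ N k) f)
      = E.integral (windowMoment φ N k) f := by
    rw [proj_integral hm measurableSet_Ico, windowMoment, Set.indicator_indicator, Set.inter_self]
  have h2 := hA (E.integral (windowMoment φ N k) f)
  rw [h1] at h2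
  refine h2.trans ?_
  have h3 := (hI.const_smul (b : ℂ)).norm_le_of_le
    (((isIntegral_one (E := E) f).proj (B := Set.Ico (N : ℝ) (N + 1)) measurableSet_Ico).const_smul
      (K : ℂ)) fun x => ?_
  · rwa [norm_smul, norm_smul, Complex.norm_real, Complex.norm_real, Real.norm_of_nonneg hb,
      Real.norm_of_nonneg hK] at h3
  · simp only [Pi.smul_apply, smul_eq_mul, norm_mul, Complex.norm_real, Real.norm_of_nonneg hb,
      Real.norm_of_nonneg hK]
    by_cases hx : x ∈ Set.Ico (N : ℝ) (N + 1)
    · rw [Set.indicator_of_mem hx, Pi.one_apply, norm_one, mul_one]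
      refine le_trans ?_ (hbK x hx)
      gcongr
      exact norm_windowMoment_le φ N k x
    · rw [windowMoment, Set.indicator_of_notMem hx, Set.indicator_of_notMem hx]
      simp

/-- The coefficient of `(x - N)^k` in the Taylor expansion of `e^{-itx}` at `x = N`. -/
def taylorCoeff (t : ℝ) (N k : ℕ) : ℂ :=
  ((-(Complex.I * t)) ^ k / (k.factorial : ℂ)) * Complex.exp (-(Complex.I * t * N))

/-- `φ(x) e^{-itx}` with the phase Taylor expanded to order `n` on each of the first `n` windows. -/
def truncatedSymbol (φ : ℝ → ℂ) (t : ℝ) (n : ℕ) : ℝ → ℂ :=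
  ∑ k ∈ Finset.range n, ∑ N ∈ Finset.range n, taylorCoeff t N k • windowMoment φ N k

/-- A point x ≥ 0 lies in exactly one window, the one at its integer part, so the sum over N has at
most one nonzero term. -/
theorem truncatedSymbol_apply (φ : ℝ → ℂ) (t : ℝ) (n : ℕ) {x : ℝ} (hx : 0 ≤ x) :
    truncatedSymbol φ t n x = if ⌊x⌋₊ < n then
      (∑ k ∈ Finset.range n, (-(Complex.I * t * (x - ⌊x⌋₊ : ℂ))) ^ k / (k.factorial : ℂ))
        * (Complex.exp (-(Complex.I * t * ⌊x⌋₊)) * φ x) else 0 := by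
  have h : ∀ k, ∑ N ∈ Finset.range n, taylorCoeff t N k * windowMoment φ N k x
      = if ⌊x⌋₊ < n then (-(Complex.I * t * (x - ⌊x⌋₊ : ℂ))) ^ k / (k.factorial : ℂ)
        * (Complex.exp (-(Complex.I * t * ⌊x⌋₊)) * φ x) else 0 := by
    intro k
    have h1 : ∀ N, taylorCoeff t N k * windowMoment φ N k x = if ⌊x⌋₊ = N then
        (-(Complex.I * t * (x - ⌊x⌋₊ : ℂ))) ^ k / (k.factorial : ℂ)
        * (Complex.exp (-(Complex.I * t * ⌊x⌋₊)) * φ x) else 0 := by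
      intro N
      simp only [windowMoment, Set.indicator, mem_Ico_iff_floor_eq hx]
      split_ifs with hN
      · subst hN
        have : -(Complex.I * t * (x - ⌊x⌋₊ : ℂ)) = -(Complex.I * t) * (x - ⌊x⌋₊ : ℂ) := by ring
        rw [taylorCoeff, this, mul_pow]
        ring
      · rw [mul_zero]
    simp_rw [h1]
    rw [Finset.sum_ite_eq]
    simp
  simp only [truncatedSymbol, Finset.sum_apply, Pi.smul_apply, smul_eq_mul]
  simp_rw [h]
  split_ifs
  · rw [Finset.sum_mul]
  · simp

theorem norm_truncatedSymbol_le (φ : ℝ → ℂ) (t : ℝ) (n : ℕ) {x : ℝ} (hx : 0 ≤ x) :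
    ‖truncatedSymbol φ t n x‖ ≤ Real.exp |t| * ‖φ x‖ := by
  rw [truncatedSymbol_apply φ t n hx]
  split_ifs
  · have h1 : ‖Complex.exp (-(Complex.I * t * ⌊x⌋₊))‖ = 1 := norm_phase t ⌊x⌋₊
    rw [norm_mul, norm_mul, h1, one_mul]
    gcongr
    refine (norm_sum_le _ _).trans (le_trans ?_ (Real.sum_le_exp_of_nonneg (abs_nonneg t) n))
    refine Finset.sum_le_sum fun k _ => ?_
    rw [norm_div, norm_pow, Complex.norm_natCast]
    gcongr
    have h2 : (x - ⌊x⌋₊ : ℂ) = ((x - ⌊x⌋₊ : ℝ) : ℂ) := by push_cast; ring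
    rw [norm_neg, norm_mul, norm_mul, Complex.norm_I, one_mul, h2, Complex.norm_real,
      Complex.norm_real, Real.norm_of_nonneg (sub_nonneg.2 (Nat.floor_le hx))]
    exact mul_le_of_le_one_right (abs_nonneg t) (by linarith [Nat.lt_floor_add_one x])
  · rw [norm_zero]
    positivity

theorem tendsto_truncatedSymbol (φ : ℝ → ℂ) (t : ℝ) {x : ℝ} (hx : 0 ≤ x) :
    Tendsto (fun n => truncatedSymbol φ t n x) atTop (𝓝 ((φ * phase t) x)) := by
  have h1 : Tendsto (fun n => (∑ k ∈ Finset.range n,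
      (-(Complex.I * t * (x - ⌊x⌋₊ : ℂ))) ^ k / (k.factorial : ℂ))
        * (Complex.exp (-(Complex.I * t * ⌊x⌋₊)) * φ x)) atTop
      (𝓝 (Complex.exp (-(Complex.I * t * (x - ⌊x⌋₊ : ℂ)))
        * (Complex.exp (-(Complex.I * t * ⌊x⌋₊)) * φ x))) := by
    refine Tendsto.mul_const _ ?_
    have := NormedSpace.expSeries_div_hasSum_exp (𝔸 := ℂ) (-(Complex.I * t * (x - ⌊x⌋₊ : ℂ)))
    rw [← Complex.exp_eq_exp_ℂ] at this
    exact this.tendsto_sum_nat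
  have h2 : Complex.exp (-(Complex.I * t * (x - ⌊x⌋₊ : ℂ)))
        * (Complex.exp (-(Complex.I * t * ⌊x⌋₊)) * φ x) = (φ * phase t) x := by
    rw [← mul_assoc, ← Complex.exp_add, mul_comm]
    simp only [Pi.mul_apply, phase]
    congr 2
    ring
  rw [h2] at h1
  refine h1.congr' ?_
  filter_upwards [eventually_gt_atTop ⌊x⌋₊] with n hn
  rw [truncatedSymbol_apply φ t n hx, if_pos hn]

theorem isIntegral_truncatedSymbol {φ : ℝ → ℂ} (hφ : Measurable φ) {f : 𝓗}
    (hf : MemLp φ 2 (E.scalarMeasure f)) (t : ℝ) (n : ℕ) :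
    E.IsIntegral (truncatedSymbol φ t n) f (∑ k ∈ Finset.range n, ∑ N ∈ Finset.range n,
      taylorCoeff t N k • E.integral (windowMoment φ N k) f) :=
  IsIntegral.sum _ fun k _ => IsIntegral.sum _ fun N _ =>
    (isIntegral_integral (memLp_windowMoment hφ hf N k)).const_smul _

theorem tendsto_integral_truncatedSymbol {φ : ℝ → ℂ} (hφ : Measurable φ) {f : 𝓗}
    (hf : MemLp φ 2 (E.scalarMeasure f)) (hE : E.proj (Set.Iio 0) f = 0) (t : ℝ) :
    Tendsto (fun n => E.integral (truncatedSymbol φ t n) f) atTop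
      (𝓝 (E.integral (φ * phase t) f)) := by
  have hpos := ae_nonneg_of_proj_Iio hE
  refine tendsto_integral_of_dominated (fun n => (isIntegral_truncatedSymbol hφ hf t n).1)
    (memLp_mul_phase hf t) (G := fun x => (Real.exp |t| + 1) * ‖φ x‖) (hf.norm.const_mul _)
    (fun n => ?_) ?_
  · filter_upwards [hpos] with x hx
    refine (norm_sub_le _ _).trans ?_
    rw [add_mul, one_mul]
    refine add_le_add (norm_truncatedSymbol_le φ t n hx) ?_
    simp [norm_phase]
  · filter_upwards [hpos] with x hx using tendsto_truncatedSymbol φ t hx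

/-- Cauchy–Schwarz with weights T^k/k!, whose sum is at most e^T. What remains for each k is the
squared norm of a trigonometric polynomial, ready for Parseval. -/
theorem norm_sq_sum_taylorCoeff_le {F : Type*} [NormedAddCommGroup F] [NormedSpace ℂ F]
    (v : ℕ → ℕ → F) (n : ℕ) {t T : ℝ} (ht : |t| ≤ T) :
    ‖∑ k ∈ Finset.range n, ∑ N ∈ Finset.range n, taylorCoeff t N k • v N k‖ ^ 2
      ≤ Real.exp T * ∑ k ∈ Finset.range n, T ^ k / (k.factorial : ℝ)
        * ‖∑ N ∈ Finset.range n, Complex.exp (-(Complex.I * t * N)) • v N k‖ ^ 2 := by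
  have hT : 0 ≤ T := (abs_nonneg t).trans ht
  set w : ℕ → F := fun k => ∑ N ∈ Finset.range n, Complex.exp (-(Complex.I * t * N)) • v N k
  have h1 : ‖∑ k ∈ Finset.range n, ∑ N ∈ Finset.range n, taylorCoeff t N k • v N k‖
      ≤ ∑ k ∈ Finset.range n, T ^ k / (k.factorial : ℝ) * ‖w k‖ := by
    refine (norm_sum_le _ _).trans (Finset.sum_le_sum fun k _ => ?_)
    have : ∑ N ∈ Finset.range n, taylorCoeff t N k • v N k
        = ((-(Complex.I * t)) ^ k / (k.factorial : ℂ)) • w k := by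
      simp only [w, Finset.smul_sum, smul_smul, taylorCoeff]
    rw [this, norm_smul, norm_div, norm_pow, norm_neg, norm_mul, Complex.norm_I, one_mul,
      Complex.norm_real, Complex.norm_natCast, Real.norm_eq_abs]
    gcongr
  calc _ ≤ (∑ k ∈ Finset.range n, T ^ k / (k.factorial : ℝ) * ‖w k‖) ^ 2 := by gcongr
    _ ≤ (∑ k ∈ Finset.range n, T ^ k / (k.factorial : ℝ))
        * ∑ k ∈ Finset.range n, T ^ k / (k.factorial : ℝ) * ‖w k‖ ^ 2 :=
      Finset.sum_sq_le_sum_mul_sum_of_sq_le_mul _ (fun _ _ => by positivity)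
        (fun _ _ => by positivity) (fun _ _ => le_of_eq (by ring))
    _ ≤ _ := by
      gcongr
      exact Real.sum_le_exp_of_nonneg hT n

/-- In e^{4π} one factor e^{2π} comes from Cauchy–Schwarz and the other from summing the weights
(2π)^k/k! after Parseval. -/
theorem lintegral_truncated_le {V : Type*} [NormedAddCommGroup V] [InnerProductSpace ℂ V]
    (v : ℕ → ℕ → V) (n : ℕ) {M : ℝ}
    (hv : ∀ k, ∑ N ∈ Finset.range n, ‖v N k‖ ^ 2 ≤ M) :
    ∫⁻ t in Set.Ioc (0 : ℝ) (2 * Real.pi),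
      ‖∑ k ∈ Finset.range n, ∑ N ∈ Finset.range n, taylorCoeff t N k • v N k‖ₑ ^ 2
      ≤ ENNReal.ofReal (2 * Real.pi * Real.exp (4 * Real.pi) * M) := by
  have hM : 0 ≤ M := (Finset.sum_nonneg fun _ _ => by positivity).trans (hv 0)
  have hpi := Real.pi_pos
  set p : ℕ → ℝ := fun k => (2 * Real.pi) ^ k / (k.factorial : ℝ)
  set F : ℝ → ℝ := fun t => Real.exp (2 * Real.pi) * ∑ k ∈ Finset.range n, p k
    * ‖∑ N ∈ Finset.range n, Complex.exp (-(Complex.I * t * N)) • v N k‖ ^ 2 with hF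
  have hFc : Continuous F := by fun_prop
  calc _ ≤ ∫⁻ t in Set.Ioc (0 : ℝ) (2 * Real.pi), ENNReal.ofReal (F t) := by
        refine setLIntegral_mono' measurableSet_Ioc fun t ht => ?_
        rw [← ofReal_norm, ← ENNReal.ofReal_pow (norm_nonneg _)]
        refine ENNReal.ofReal_le_ofReal (norm_sq_sum_taylorCoeff_le v n ?_)
        rw [abs_of_pos ht.1]
        exact ht.2
    _ = ENNReal.ofReal (∫ t in Set.Ioc (0 : ℝ) (2 * Real.pi), F t) := by
        rw [ofReal_integral_eq_lintegral_ofReal hFc.integrableOn_Ioc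
          (Eventually.of_forall fun t => by simp only [hF, p]; positivity)]
    _ ≤ _ := by
        refine ENNReal.ofReal_le_ofReal ?_
        rw [← intervalIntegral.integral_of_le (by positivity), hF,
          intervalIntegral.integral_const_mul, intervalIntegral.integral_finsetSum
            (fun N _ => Continuous.intervalIntegrable (by fun_prop) _ _)]
        simp_rw [intervalIntegral.integral_const_mul, integral_norm_sq_trigPoly]
        have h1 : ∑ k ∈ Finset.range n, p k * (2 * Real.pi * ∑ N ∈ Finset.range n, ‖v N k‖ ^ 2)
            ≤ ∑ k ∈ Finset.range n, p k * (2 * Real.pi * M) := by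
          refine Finset.sum_le_sum fun k _ => ?_
          have := hv k
          gcongr
        rw [← Finset.sum_mul] at h1
        have h2 : ∑ k ∈ Finset.range n, p k ≤ Real.exp (2 * Real.pi) :=
          Real.sum_le_exp_of_nonneg (by positivity) n
        calc _ ≤ Real.exp (2 * Real.pi) * ((∑ k ∈ Finset.range n, p k) * (2 * Real.pi * M)) := by
              gcongr
          _ ≤ Real.exp (2 * Real.pi) * (Real.exp (2 * Real.pi) * (2 * Real.pi * M)) := by gcongr
          _ = _ := by
              have : Real.exp (4 * Real.pi) = Real.exp (2 * Real.pi) * Real.exp (2 * Real.pi) := by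
                rw [← Real.exp_add]; congr 1; ring
              rw [this]; ring

/-- Bounds for `A` on the spectral windows `[N, N + 1)` give a time-averaged bound for
`A φ(H) e^{-itH}`. -/
theorem lintegral_norm_sq_le_of_norm_apply_proj_le {φ : ℝ → ℂ} (hφ : Measurable φ)
    (A : 𝓗 →L[ℂ] 𝓗) {b : ℕ → ℝ} {K : ℝ} (hb : ∀ N, 0 ≤ b N) (hK : 0 ≤ K)
    (hA : ∀ (N : ℕ) (f : 𝓗), ‖A (E.proj (Set.Ico (N : ℝ) (N + 1)) f)‖
      ≤ b N * ‖E.proj (Set.Ico (N : ℝ) (N + 1)) f‖)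
    (hbK : ∀ N : ℕ, ∀ x ∈ Set.Ico (N : ℝ) (N + 1), b N * ‖φ x‖ ≤ K) {f : 𝓗}
    (hf : MemLp φ 2 (E.scalarMeasure f)) (hE : E.proj (Set.Iio 0) f = 0) :
    ∫⁻ t in Set.Ioc (0 : ℝ) (2 * Real.pi), ‖A (E.integral (φ * phase t) f)‖ₑ ^ 2
      ≤ ENNReal.ofReal (2 * Real.pi * Real.exp (4 * Real.pi) * (K ^ 2 * ‖f‖ ^ 2)) := by
  set v : ℕ → ℕ → 𝓗 := fun N k => A (E.integral (windowMoment φ N k) f)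
  set S : ℕ → ℝ → 𝓗 := fun n t =>
    ∑ k ∈ Finset.range n, ∑ N ∈ Finset.range n, taylorCoeff t N k • v N k with hS
  have hSeq : ∀ n t, S n t = A (E.integral (truncatedSymbol φ t n) f) := by
    intro n t
    rw [(isIntegral_truncatedSymbol hφ hf t n).integral_eq]
    simp only [hS, v, map_sum, map_smul]
  have hScont : ∀ n, Continuous (S n) := by
    intro n
    simp only [hS, taylorCoeff]
    fun_prop
  have hlim : ∀ t, Tendsto (fun n => ‖S n t‖ₑ ^ 2) atTop
      (𝓝 (‖A (E.integral (φ * phase t) f)‖ₑ ^ 2)) := by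
    intro t
    simp_rw [hSeq]
    exact ENNReal.Tendsto.pow
      ((A.continuous.tendsto _).comp (tendsto_integral_truncatedSymbol hφ hf hE t)).enorm
  have hv : ∀ n k, ∑ N ∈ Finset.range n, ‖v N k‖ ^ 2 ≤ K ^ 2 * ‖f‖ ^ 2 := by
    intro n k
    calc _ ≤ ∑ N ∈ Finset.range n, K ^ 2 * ‖E.proj (Set.Ico (N : ℝ) (N + 1)) f‖ ^ 2 := by
          refine Finset.sum_le_sum fun N _ => ?_
          rw [← mul_pow]
          gcongr
          exact norm_apply_windowMoment_le hφ A (hb N) hK (hA N) (hbK N) hf k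
      _ ≤ _ := by
          rw [← Finset.mul_sum]
          gcongr
          exact sum_norm_sq_proj_le f n
  -- Fatou's lemma: the truncations converge for each t and their time integrals are bounded
  -- uniformly in n.
  calc _ = ∫⁻ t in Set.Ioc (0 : ℝ) (2 * Real.pi), liminf (fun n => ‖S n t‖ₑ ^ 2) atTop := by
        simp_rw [fun t => (hlim t).liminf_eq]
    _ ≤ liminf (fun n => ∫⁻ t in Set.Ioc (0 : ℝ) (2 * Real.pi), ‖S n t‖ₑ ^ 2) atTop :=
        lintegral_liminf_le fun n => ((hScont n).enorm.measurable.pow_const 2)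
    _ ≤ liminf (fun _ : ℕ => ENNReal.ofReal
          (2 * Real.pi * Real.exp (4 * Real.pi) * (K ^ 2 * ‖f‖ ^ 2))) atTop :=
        liminf_le_liminf (Eventually.of_forall fun n => lintegral_truncated_le v n (hv n))
    _ = _ := liminf_const _

end ProjectionMeasure

/-! ### Reduction of the weight to bounded multiplication operators -/

/-- The weight `Ψ` cut off to the closed ball of radius `R`. -/
def truncatedWeight {d : ℕ} (Ψ : EuclideanSpace ℝ (Fin d) → ℝ) (R : ℕ) :
    EuclideanSpace ℝ (Fin d) → ℂ :=
  (Metric.closedBall 0 (R : ℝ)).indicator fun x => (Ψ x : ℂ)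

theorem memLp_truncatedWeight {d : ℕ} {Ψ : EuclideanSpace ℝ (Fin d) → ℝ} (hΨ : Continuous Ψ)
    (R : ℕ) : MemLp (truncatedWeight Ψ R) ∞ volume := by
  obtain ⟨C, hC⟩ := (isCompact_closedBall (0 : EuclideanSpace ℝ (Fin d))
    (R : ℝ)).exists_bound_of_continuousOn hΨ.continuousOn
  have hm : Measurable (truncatedWeight Ψ R) :=
    (Complex.measurable_ofReal.comp hΨ.measurable).indicator measurableSet_closedBall
  refine memLp_top_of_bound hm.aestronglyMeasurable (max C 0) (Eventually.of_forall fun x => ?_)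
  by_cases hx : x ∈ Metric.closedBall (0 : EuclideanSpace ℝ (Fin d)) (R : ℝ)
  · rw [truncatedWeight, Set.indicator_of_mem hx, Complex.norm_real]
    exact (hC x hx).trans (le_max_left _ _)
  · rw [truncatedWeight, Set.indicator_of_notMem hx, norm_zero]
    exact le_max_right _ _

/-- Multiplication by the truncated weight, a bounded operator on `L²`. -/
def truncatedMul {d : ℕ} {Ψ : EuclideanSpace ℝ (Fin d) → ℝ} (hΨ : Continuous Ψ) (R : ℕ) :
    L2Space d →L[ℂ] L2Space d :=
  (ContinuousLinearMap.mul ℂ ℂ).holderL volume ∞ 2 2 (memLp_truncatedWeight hΨ R).toLp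

theorem enorm_sq_truncatedMul {d : ℕ} {Ψ : EuclideanSpace ℝ (Fin d) → ℝ} (hΨ : Continuous Ψ)
    (R : ℕ) (g : L2Space d) : ‖truncatedMul hΨ R g‖ₑ ^ 2
      = ∫⁻ x in Metric.closedBall 0 (R : ℝ), ‖(Ψ x : ℂ) * g x‖ₑ ^ 2 := by
  rw [Lp.enorm_def, eLpNorm_two_sq, ← lintegral_indicator measurableSet_closedBall]
  refine lintegral_congr_ae ?_
  filter_upwards [(ContinuousLinearMap.mul ℂ ℂ).coeFn_holder (r := 2)
    (memLp_truncatedWeight hΨ R).toLp g, (memLp_truncatedWeight hΨ R).coeFn_toLp] with x h1 h2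
  have h3 : truncatedMul hΨ R g x = truncatedWeight Ψ R x * g x := by
    rw [← h2]; exact h1
  rw [h3]
  by_cases hx : x ∈ Metric.closedBall (0 : EuclideanSpace ℝ (Fin d)) (R : ℝ) <;>
    simp [truncatedWeight, hx]

/-- The balls increase to the whole space. The identity also covers the value ∞, so square
integrability of Ψg never has to be assumed. -/
theorem weightedNorm_sq_eq_iSup {d : ℕ} {Ψ : EuclideanSpace ℝ (Fin d) → ℝ} (hΨ : Continuous Ψ)
    (g : L2Space d) : weightedNorm Ψ g ^ 2 = ⨆ R : ℕ, ‖truncatedMul hΨ R g‖ₑ ^ 2 := by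
  simp_rw [enorm_sq_truncatedMul]
  rw [weightedNorm, eLpNorm_two_sq, ← setLIntegral_univ,
    ← Metric.iUnion_closedBall_nat (0 : EuclideanSpace ℝ (Fin d))]
  refine setLIntegral_iUnion_of_directed _ (Monotone.directed_le ?_)
  intro m n hmn
  exact Metric.closedBall_subset_closedBall (by exact_mod_cast hmn)

theorem monotone_enorm_sq_truncatedMul {d : ℕ} {Ψ : EuclideanSpace ℝ (Fin d) → ℝ}
    (hΨ : Continuous Ψ) (g : L2Space d) : Monotone fun R : ℕ => ‖truncatedMul hΨ R g‖ₑ ^ 2 := by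
  intro m n hmn
  simp only [enorm_sq_truncatedMul]
  exact lintegral_mono_set (Metric.closedBall_subset_closedBall (by exact_mod_cast hmn))

theorem enorm_truncatedMul_le {d : ℕ} {Ψ : EuclideanSpace ℝ (Fin d) → ℝ} (hΨ : Continuous Ψ)
    (R : ℕ) (g : L2Space d) : ‖truncatedMul hΨ R g‖ₑ ≤ weightedNorm Ψ g := by
  rw [← ENNReal.pow_le_pow_left_iff two_ne_zero, weightedNorm_sq_eq_iSup hΨ]
  exact le_iSup (fun R : ℕ => ‖truncatedMul hΨ R g‖ₑ ^ 2) R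

theorem weightedNorm_le_of_forall {d : ℕ} {Ψ : EuclideanSpace ℝ (Fin d) → ℝ} (hΨ : Continuous Ψ)
    {g : L2Space d} {C : ℝ} (h : ∀ R, ‖truncatedMul hΨ R g‖ ≤ C) :
    weightedNorm Ψ g ≤ ENNReal.ofReal C := by
  rw [← ENNReal.pow_le_pow_left_iff two_ne_zero, weightedNorm_sq_eq_iSup hΨ]
  refine iSup_le fun R => ?_
  gcongr
  rw [← ofReal_norm]
  exact ENNReal.ofReal_le_ofReal (h R)

theorem norm_truncatedMul_le {d : ℕ} {Ψ : EuclideanSpace ℝ (Fin d) → ℝ} (hΨ : Continuous Ψ)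
    {g : L2Space d} {C : ℝ} (hC : 0 ≤ C) (h : weightedNorm Ψ g ≤ ENNReal.ofReal C) (R : ℕ) :
    ‖truncatedMul hΨ R g‖ ≤ C := by
  have := (enorm_truncatedMul_le hΨ R g).trans h
  rwa [← ofReal_norm, ENNReal.ofReal_le_ofReal_iff hC] at this

/-! ### Size of the Japanese bracket on a window -/

theorem continuous_japanesePow (s : ℝ) : Continuous (japanesePow s) := by
  unfold japanesePow
  refine Complex.continuous_ofReal.comp ?_
  refine Continuous.rpow_const (by fun_prop) fun x => Or.inl ?_
  positivity

theorem norm_japanesePow (s x : ℝ) : ‖japanesePow s x‖ = (1 + x ^ 2) ^ (s / 2) := by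
  rw [japanesePow, Complex.norm_real, Real.norm_of_nonneg (by positivity)]

theorem one_le_norm_japanesePow {s : ℝ} (hs : 0 ≤ s) (x : ℝ) : 1 ≤ ‖japanesePow s x‖ := by
  rw [norm_japanesePow]
  exact Real.one_le_rpow (by nlinarith [sq_nonneg x]) (by positivity)

theorem sq_rpow_half {a : ℝ} (ha : 0 ≤ a) (s : ℝ) : (a ^ 2) ^ (s / 2) = a ^ s := by
  rw [← Real.rpow_natCast a 2, ← Real.rpow_mul ha]
  congr 1
  push_cast
  ring

theorem rpow_le_norm_japanesePow {s a x : ℝ} (hs : 0 ≤ s) (ha : 0 ≤ a) (hx : a ≤ x) :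
    a ^ s ≤ ‖japanesePow s x‖ := by
  rw [norm_japanesePow, ← sq_rpow_half ha]
  exact Real.rpow_le_rpow (by positivity) (by nlinarith) (by positivity)

/-- The 5 comes from 1 + x² ≤ a² + 4a². The condition x ≤ 2a covers [N, N+1) with a = N when N ≥ 1,
and [0, 1) with a = 1. -/
theorem norm_japanesePow_le {s a x : ℝ} (hs : 0 ≤ s) (ha : 1 ≤ a) (h0 : 0 ≤ x)
    (hx : x ≤ 2 * a) : ‖japanesePow s x‖ ≤ 5 ^ (s / 2) * a ^ s := by
  rw [norm_japanesePow, ← sq_rpow_half (zero_le_one.trans ha), ← Real.mul_rpow (by norm_num)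
    (by positivity)]
  exact Real.rpow_le_rpow (by positivity) (by nlinarith) (by positivity)

/-! ### Application to H and the equivalence -/

section

variable {𝓗 : Type*} [NormedAddCommGroup 𝓗] [InnerProductSpace ℂ 𝓗] [CompleteSpace 𝓗]

/-- The projection-valued measure `spectralMeasure H` of a nonnegative operator is supported in
`[0, ∞)`. Self-adjointness, which guarantees `Represents`, is not needed: every bound below holds
for an arbitrary projection-valued measure supported in `[0, ∞)`. -/
theorem spectralMeasure_proj_Iio {H : 𝓗 →ₗ.[ℂ] 𝓗} (hpos : OperatorNonneg H) (f : 𝓗) :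
    (spectralMeasure H).proj (Set.Iio 0) f = 0 := by
  rw [spectralMeasure]
  split_ifs with h
  · exact ProjectionMeasure.proj_Iio_zero_of_represents h.choose_spec hpos f
  · simp [ProjectionMeasure.dirac]

theorem funcCalc_propagator (H : 𝓗 →ₗ.[ℂ] 𝓗) {φ : ℝ → ℂ} (hφ : Measurable φ) {f : 𝓗}
    (hf : f ∈ funcDomain H φ) (t : ℝ) : funcCalc H φ (propagator H t f)
      = (spectralMeasure H).integral (φ * ProjectionMeasure.phase t) f :=
  ProjectionMeasure.integral_integral (ProjectionMeasure.measurable_phase t) hφ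
    (ProjectionMeasure.memLp_phase t f) (ProjectionMeasure.memLp_mul_phase hf t)

end

theorem lintegral_weightedNorm_sq_eq_iSup {d : ℕ} {Ψ : EuclideanSpace ℝ (Fin d) → ℝ}
    (hΨ : Continuous Ψ) {u : ℝ → L2Space d} (hu : Continuous u) (s : Set ℝ) :
    ∫⁻ t in s, weightedNorm Ψ (u t) ^ 2 = ⨆ R : ℕ, ∫⁻ t in s, ‖truncatedMul hΨ R (u t)‖ₑ ^ 2 := by
  simp_rw [weightedNorm_sq_eq_iSup hΨ]
  refine lintegral_iSup (fun R => ?_) fun m n hmn t => monotone_enorm_sq_truncatedMul hΨ (u t) hmn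
  exact (((truncatedMul hΨ R).continuous.comp hu).enorm.measurable.pow_const 2)

end

theorem theorem1 (d : ℕ) (hd : 1 ≤ d)
    (H : L2Space d →ₗ.[ℂ] L2Space d) (hH : IsSelfAdjoint H) (hpos : OperatorNonneg H)
    (γ : ℝ) (hγ : 0 < γ)
    (Ψ : EuclideanSpace ℝ (Fin d) → ℝ) (hΨ : Continuous Ψ) :
    (∃ C₁ : ℝ, 0 < C₁ ∧ ∀ f ∈ funcDomain H (japanesePow (γ / 2)),
      (∫⁻ t in Set.Ioc (0 : ℝ) (2 * Real.pi),
          weightedNorm Ψ (funcCalc H (japanesePow (γ / 2)) (propagator H t f)) ^ (2 : ℝ))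
            ^ (1 / 2 : ℝ)
        ≤ ENNReal.ofReal (C₁ * ‖f‖)) ↔
    ((∃ C₂ : ℝ, 0 < C₂ ∧ ∀ N : ℕ, 1 ≤ N → ∀ f : L2Space d,
      weightedNorm Ψ (spectralProjector H N f)
        ≤ ENNReal.ofReal (C₂ * (N : ℝ) ^ (-(γ / 2)) * ‖spectralProjector H N f‖)) ∧
    (∃ C₀ : ℝ, 0 < C₀ ∧ ∀ f : L2Space d,
      weightedNorm Ψ (spectralProjector H 0 f)
        ≤ ENNReal.ofReal (C₀ * ‖spectralProjector H 0 f‖))) := by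
  have hφ : Measurable (japanesePow (γ / 2)) := (continuous_japanesePow _).measurable
  have hs : 0 ≤ γ / 2 := by positivity
  have hroot : ∀ X Y : ℝ≥0∞, X ^ (1 / 2 : ℝ) ≤ Y ↔ X ≤ Y ^ 2 := by
    intro X Y
    rw [one_div, ENNReal.rpow_inv_le_iff (by norm_num), ENNReal.rpow_two]
  -- Monotone convergence in space and time: the weighted estimate holds exactly when all cutoffs
  -- satisfy it with the same constant.
  have hstate : ∀ f ∈ funcDomain H (japanesePow (γ / 2)), ∀ C : ℝ,
      ((∫⁻ t in Set.Ioc (0 : ℝ) (2 * Real.pi),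
          weightedNorm Ψ (funcCalc H (japanesePow (γ / 2)) (propagator H t f)) ^ (2 : ℝ))
            ^ (1 / 2 : ℝ) ≤ ENNReal.ofReal C) ↔
      ∀ R : ℕ, ∫⁻ t in Set.Ioc (0 : ℝ) (2 * Real.pi), ‖truncatedMul hΨ R
        ((spectralMeasure H).integral (japanesePow (γ / 2) * ProjectionMeasure.phase t) f)‖ₑ ^ 2
          ≤ ENNReal.ofReal C ^ 2 := by
    intro f hf C
    simp_rw [hroot, ENNReal.rpow_two, funcCalc_propagator H hφ hf]
    rw [lintegral_weightedNorm_sq_eq_iSup hΨ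
      (ProjectionMeasure.continuous_integral_mul_phase hf), iSup_le_iff]
  constructor
  · rintro ⟨C, hC, h⟩
    have key : ∀ (N : ℕ) (b : ℝ), 0 < b →
        (∀ x ∈ Set.Ico (N : ℝ) (N + 1), b ≤ ‖japanesePow (γ / 2) x‖) → ∀ f : L2Space d,
        weightedNorm Ψ (spectralProjector H N f)
          ≤ ENNReal.ofReal (4 * C / b * ‖spectralProjector H N f‖) := fun N b hb hbφ f =>
      weightedNorm_le_of_forall hΨ fun R =>
        ProjectionMeasure.norm_apply_proj_le_of_lintegral hφ (truncatedMul hΨ R) hC.le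
          (fun f hf => (hstate f hf _).1 (h f hf) R) hb hbφ f
    refine ⟨⟨4 * C, by positivity, fun N hN f => ?_⟩, ⟨4 * C, by positivity, fun f => ?_⟩⟩
    · have hN0 : (0 : ℝ) < N := by exact_mod_cast hN
      have := key N ((N : ℝ) ^ (γ / 2)) (by positivity)
        (fun x hx => rpow_le_norm_japanesePow hs hN0.le hx.1) f
      rwa [div_eq_mul_inv, ← Real.rpow_neg hN0.le] at this
    · have := key 0 1 one_pos (fun x _ => one_le_norm_japanesePow hs x) f
      rwa [div_one] at this
  · rintro ⟨⟨C₂, hC₂, h₂⟩, ⟨C₀, hC₀, h₀⟩⟩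
    -- The window N = 0 needs its own constant: there the power of N takes the default value 0.
    set b : ℕ → ℝ := fun N => if N = 0 then C₀ else C₂ * (N : ℝ) ^ (-(γ / 2)) with hbdef
    have hb : ∀ N, 0 ≤ b N := by
      intro N
      simp only [hbdef]
      split_ifs <;> positivity
    set K : ℝ := (C₀ + C₂) * 5 ^ (γ / 2 / 2) with hKdef
    have hK : 0 < K := by positivity
    have hbK : ∀ N : ℕ, ∀ x ∈ Set.Ico (N : ℝ) (N + 1), b N * ‖japanesePow (γ / 2) x‖ ≤ K := by
      intro N x hx
      have hx0 : 0 ≤ x := (Nat.cast_nonneg N).trans hx.1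
      have h5 : (0 : ℝ) < 5 ^ (γ / 2 / 2) := by positivity
      rcases Nat.eq_zero_or_pos N with rfl | hN
      · have h1 := norm_japanesePow_le hs le_rfl hx0
          (by have := hx.2; norm_num at this; linarith)
        rw [Real.one_rpow, mul_one] at h1
        simp only [hbdef, if_true]
        calc _ ≤ C₀ * 5 ^ (γ / 2 / 2) := by gcongr
          _ ≤ K := by rw [hKdef]; gcongr; linarith
      · have hN1 : (1 : ℝ) ≤ N := by exact_mod_cast hN
        have h1 := norm_japanesePow_le hs hN1 hx0 (by linarith [hx.2])
        simp only [hbdef, if_neg hN.ne']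
        have h2 : (N : ℝ) ^ (-(γ / 2)) * (N : ℝ) ^ (γ / 2) = 1 := by
          rw [← Real.rpow_add (by linarith)]; simp
        calc _ ≤ C₂ * (N : ℝ) ^ (-(γ / 2)) * (5 ^ (γ / 2 / 2) * (N : ℝ) ^ (γ / 2)) := by gcongr
          _ = C₂ * 5 ^ (γ / 2 / 2) * ((N : ℝ) ^ (-(γ / 2)) * (N : ℝ) ^ (γ / 2)) := by ring
          _ = C₂ * 5 ^ (γ / 2 / 2) := by rw [h2, mul_one]
          _ ≤ K := by rw [hKdef]; gcongr; linarith
    have hA : ∀ (R N : ℕ) (f : L2Space d),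
        ‖truncatedMul hΨ R (spectralProjector H N f)‖ ≤ b N * ‖spectralProjector H N f‖ := by
      intro R N f
      refine norm_truncatedMul_le hΨ (mul_nonneg (hb N) (norm_nonneg _)) ?_ R
      rcases Nat.eq_zero_or_pos N with rfl | hN
      · exact h₀ f
      · simpa only [hbdef, if_neg hN.ne'] using h₂ N hN f
    -- The square root of the constant in the squared time-averaged bound, which does not depend on
    -- R.
    refine ⟨√(2 * Real.pi * Real.exp (4 * Real.pi)) * K, by positivity, fun f hf => ?_⟩
    rw [hstate f hf]
    intro R
    refine (ProjectionMeasure.lintegral_norm_sq_le_of_norm_apply_proj_le hφ (truncatedMul hΨ R) hb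
      hK.le (hA R) hbK hf (spectralMeasure_proj_Iio hpos f)).trans (le_of_eq ?_)
    rw [← ENNReal.ofReal_pow (by positivity), mul_pow _ ‖f‖, mul_pow _ K,
      Real.sq_sqrt (by positivity), mul_assoc _ (K ^ 2)]
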